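/- Let $n\ge 0$ and let $\mathcal A=\{H_1,\dots,H_d\}$, $d\ge 1$, be an arrangement of distinct hyperplanes $H_\ell=\{f_\ell=0\}$ in $\mathbb P^n$, with $f_\ell$ a nonzero linear form on $\mathbb C^{n+1}$, and let $\mathbf m=(m_1,\dots,m_d)$ be a vector of positive integers. Write $X(\mathcal A)=\mathbb P^n\setminus\bigcup_\ell H_\ell$, and let $F(\mathcal A,\mathbf m)=\{x\in\mathbb C^{n+1}\mid \prod_\ell f_\ell(x)^{m_\ell}=1\}$ be the Milnor fiber, with its Milnor cover $F(\mathcal A,\mathbf m)\to X(\mathcal A)$, $x\mapsto[x]$. Let $\mathcal P_{m_1}$ be the arrangement of the $m_1$ lines $y_1-j\,y_2=0$, $0\le j\le m_1-1$, in $\mathbb C^2$, and let the parallel connection $\mathcal A\circ_{H_1}\mathcal P_{m_1}$ be the multiarrangement in $\mathbb C^{n+2}$, with coordinates $(x,y_2)\in\mathbb C^{n+1}\times\mathbb C$, defined by $$f_1(x)\cdot\prod_{\ell=2}^{d}f_\ell(x)^{m_\ell}\cdot\prod_{j=1}^{m_1-1}\bigl(f_1(x)-j\,y_2\bigr).$$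 Denote by $X(\mathcal A\circ_{H_1}\mathcal P_{m_1})\subset\mathbb P^{n+1}$ its complement, and by $F(\mathcal A\circ_{H_1}\mathcal P_{m_1})\subset\mathbb C^{n+2}$ its Milnor fiber, with Milnor cover $z\mapsto[z]$. (1) For every base point $[b_1:b_2]\in\mathbb P^1$ off the lines of $\mathcal P_{m_1}$, let $j\colon X(\mathcal A)\to X(\mathcal A\circ_{H_1}\mathcal P_{m_1})$ be the map $[x]\mapsto[b_1x:b_2f_1(x)]$. There is a continuous map $F(\mathcal A,\mathbf m)\to F(\mathcal A\circ_{H_1}\mathcal P_{m_1})$, commuting with multiplication by the $m$-th roots of unity ($m=\sum_\ell m_\ell$), such that the square $$\begin{array}{ccc}F(\mathcal A,\mathbf m)&\longrightarrow&F(\mathcal A\circ_{H_1}\mathcal P_{m_1})\\ \downarrow&&\downarrow\\ X(\mathcal A)&\xrightarrow{\ j\ }&X(\mathcal A\circ_{H_1}\mathcal P_{m_1})\end{array}$$ whose vertical maps are the Milnor covers is a pullback square of topological spaces. (2) If $m_1\ge 3$, then for every $i\ge 1$ there is a surjective group homomorphism $$H_{i+1}\bigl(F(\mathcal A\circ_{H_1}\mathcal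 P_{m_1}),\mathbb Z\bigr)_{\mathrm{tor}}\twoheadrightarrow H_i\bigl(F(\mathcal A,\mathbf m),\mathbb Z\bigr)_{\mathrm{tor}}$$ between the torsion subgroups of singular homology. -/

import Mathlib

open CategoryTheory
open scoped LinearAlgebra.Projectivization

noncomputable section

/-- The usual topology of a complex projective space `ℙ ℂ V`: the quotient topology from the
space of nonzero vectors. -/
instance projectivizationTopology (V : Type) [NormedAddCommGroup V] [NormedSpace ℂ V] :
    TopologicalSpace (ℙ ℂ V) :=
  inferInstanceAs (TopologicalSpace (Quotient (projectivizationSetoid ℂ V)))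

/-- A central multiarrangement in the complex vector space `V`, with hyperplanes indexed by `ι`:
pairwise distinct linear hyperplanes `ker f_i`, each with a chosen defining linear form `f_i` and a
positive multiplicity `m_i`. Equivalently, a multiarrangement in the projective space `ℙ ℂ V`. -/
structure MultiArrangement (V ι : Type) [NormedAddCommGroup V] [NormedSpace ℂ V] where
  /-- the linear forms `f_i` -/
  form : ι → V →ₗ[ℂ] ℂ
  form_ne_zero : ∀ i, form i ≠ 0
  ker_ne : ∀ i j, i ≠ j → LinearMap.ker (form i) ≠ LinearMap.ker (form j)
  /-- the multiplicities `m_i` -/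
  mult : ι → ℕ
  mult_pos : ∀ i, 0 < mult i

namespace MultiArrangement

variable {V ι : Type} [NormedAddCommGroup V] [NormedSpace ℂ V]

/-- The affine complement `M(A) ⊆ V`: the vectors lying on none of the hyperplanes. -/
def affineComplement (A : MultiArrangement V ι) : Set V :=
  {x | ∀ i, A.form i x ≠ 0}

/-- The projective complement `X(A) ⊆ ℙ V`: the points (lines through the origin of `V`)
contained in none of the hyperplanes. -/
def projComplement (A : MultiArrangement V ι) : Set (ℙ ℂ V) :=
  {p | ∀ i, ¬ p.submodule ≤ LinearMap.ker (A.form i)}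

theorem mk_mem_projComplement (A : MultiArrangement V ι) (x : V) (hx : x ≠ 0) :
    Projectivization.mk ℂ x hx ∈ A.projComplement ↔ x ∈ A.affineComplement := by
  simp [projComplement, affineComplement, Projectivization.submodule_mk,
    Submodule.span_singleton_le_iff_mem]

/-- The defining polynomial `Q(A, m) = ∏ i, f_i ^ m_i`, as a function on `V`. -/
def poly [Fintype ι] (A : MultiArrangement V ι) (x : V) : ℂ :=
  ∏ i, A.form i x ^ A.mult i

/-- The Milnor fiber `F(A, m) = {x ∈ V | Q(A, m)(x) = 1}`. -/
def milnorFiber [Fintype ι] (A : MultiArrangement V ι) : Set V :=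
  {x | A.poly x = 1}

theorem milnorFiber_subset [Fintype ι] (A : MultiArrangement V ι) {x : V}
    (hx : x ∈ A.milnorFiber) : x ∈ A.affineComplement := by
  intro i hi
  have h0 : A.poly x = 0 :=
    Finset.prod_eq_zero (Finset.mem_univ i) (by rw [hi, zero_pow (A.mult_pos i).ne'])
  have h1 : A.poly x = 1 := hx
  exact one_ne_zero (h1.symm.trans h0)

theorem affineComplement_ne_zero [Nonempty ι] (A : MultiArrangement V ι) {x : V}
    (hx : x ∈ A.affineComplement) : x ≠ 0 := by
  rintro rfl
  exact hx (Classical.arbitrary ι) (map_zero _)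

theorem continuous_projectivization_mk {Y : Type} [TopologicalSpace Y] (g : Y → V)
    (hg : Continuous g) (h0 : ∀ y, g y ≠ 0) :
    Continuous fun y => Projectivization.mk ℂ (g y) (h0 y) :=
  (continuous_quotient_mk' (s := projectivizationSetoid ℂ V)).comp
    (hg.subtype_mk h0)

/-- The Milnor cover `F(A, m) → X(A)`, `x ↦ [x]`. -/
def milnorCover [Fintype ι] [Nonempty ι] (A : MultiArrangement V ι) :
    C(A.milnorFiber, A.projComplement) where
  toFun x := ⟨Projectivization.mk ℂ x.1 (A.affineComplement_ne_zero (A.milnorFiber_subset x.2)),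
    (A.mk_mem_projComplement _ _).2 (A.milnorFiber_subset x.2)⟩
  continuous_toFun :=
    (continuous_projectivization_mk _ continuous_subtype_val _).subtype_mk _

/-- The central line arrangement `P_k` in `ℂ²`, consisting of the `k` lines `y₁ - j y₂ = 0`,
`j = 0, …, k - 1`. -/
def pencil (k : ℕ) : MultiArrangement (ℂ × ℂ) (Fin k) where
  form j := LinearMap.fst ℂ ℂ ℂ - (j : ℂ) • LinearMap.snd ℂ ℂ ℂ
  form_ne_zero j h := by
    simpa using LinearMap.congr_fun h (1, 0)
  ker_ne i j hij h := by
    have hm : ((i : ℂ), (1 : ℂ)) ∈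
        LinearMap.ker (LinearMap.fst ℂ ℂ ℂ - (i : ℂ) • LinearMap.snd ℂ ℂ ℂ) := by simp
    rw [h] at hm
    simp only [LinearMap.mem_ker, LinearMap.sub_apply, LinearMap.fst_apply, LinearMap.smul_apply,
      LinearMap.snd_apply, smul_eq_mul, mul_one, sub_eq_zero] at hm
    exact hij (Fin.ext (by exact_mod_cast hm))
  mult _ := 1
  mult_pos _ := one_pos

/-- The parallel connection `A ∘_{H_h} P_{m_h}` along the hyperplane `H_h`, a multiarrangement in
`V × ℂ` with coordinates `(x, y₂)`. Its defining polynomial is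
`f_h(x) * (∏ i ≠ h, f_i(x) ^ m_i) * ∏ j = 1, …, m_h - 1, (f_h(x) - j y₂)`: it lives in the subspace
`f_h(x) = y₁` of `V × ℂ²`, on which `y₁` is eliminated, and the index `inr j` stands for the line
`y₁ - (j + 1) y₂ = 0`. -/
def parallelConnection [DecidableEq ι] (A : MultiArrangement V ι) (h : ι) :
    MultiArrangement (V × ℂ) (ι ⊕ Fin (A.mult h - 1)) where
  form := Sum.elim (fun i => A.form i ∘ₗ LinearMap.fst ℂ V ℂ)
    (fun j => A.form h ∘ₗ LinearMap.fst ℂ V ℂ - ((j : ℂ) + 1) • LinearMap.snd ℂ V ℂ)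
  form_ne_zero := by
    rintro (i | j) h0
    · exact A.form_ne_zero i (LinearMap.ext fun x => by
        simpa using LinearMap.congr_fun h0 (x, 0))
    · have := LinearMap.congr_fun h0 (0, 1)
      simp at this
      exact Nat.cast_add_one_ne_zero (R := ℂ) (j : ℕ) (by linear_combination -this)
  ker_ne := by
    have key : ∀ (i : ι) (j : Fin (A.mult h - 1)),
        LinearMap.ker (A.form i ∘ₗ LinearMap.fst ℂ V ℂ) ≠ LinearMap.ker
          (A.form h ∘ₗ LinearMap.fst ℂ V ℂ - ((j : ℂ) + 1) • LinearMap.snd ℂ V ℂ) := by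
      intro i j hk
      have hm : ((0 : V), (1 : ℂ)) ∈ LinearMap.ker (A.form i ∘ₗ LinearMap.fst ℂ V ℂ) := by simp
      rw [hk] at hm
      simp at hm
      exact Nat.cast_add_one_ne_zero (R := ℂ) (j : ℕ) (by linear_combination -hm)
    rintro (i | j) (i' | j') hne hk
    · refine A.ker_ne i i' (fun e => hne (by rw [e])) (Submodule.ext fun x => ?_)
      simpa using (Submodule.ext_iff.1 hk (x, 0))
    · exact key i j' hk
    · exact key i' j hk.symm
    · obtain ⟨x, hx⟩ : ∃ x, A.form h x ≠ 0 := by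
        by_contra hc
        push Not at hc
        exact A.form_ne_zero h (LinearMap.ext hc)
      have hj : ((j : ℂ) + 1) ≠ 0 := Nat.cast_add_one_ne_zero _
      have hm : (((j : ℂ) + 1) • x, A.form h x) ∈ LinearMap.ker
          (A.form h ∘ₗ LinearMap.fst ℂ V ℂ - ((j : ℂ) + 1) • LinearMap.snd ℂ V ℂ) := by
        simp
      have hm' : (((j : ℂ) + 1) • x, A.form h x) ∈ LinearMap.ker
          (A.form h ∘ₗ LinearMap.fst ℂ V ℂ - ((j' : ℂ) + 1) • LinearMap.snd ℂ V ℂ) := by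
        have := (Submodule.ext_iff.1 hk (((j : ℂ) + 1) • x, A.form h x)).1 hm
        simpa using this
      simp only [LinearMap.mem_ker, LinearMap.sub_apply, LinearMap.comp_apply,
        LinearMap.fst_apply, LinearMap.smul_apply, LinearMap.snd_apply, smul_eq_mul, map_smul,
        sub_eq_zero] at hm'
      have := mul_right_cancel₀ hx hm'
      have hjj : (j : ℕ) = (j' : ℕ) := by exact_mod_cast add_right_cancel this
      exact hne (congrArg Sum.inr (Fin.ext hjj))
  mult := Sum.elim (Function.update A.mult h 1) (fun _ => 1)
  mult_pos := by
    rintro (i | j)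
    · by_cases e : i = h
      · subst e; simp
      · simpa [e] using A.mult_pos i
    · simp

/-- The linear map `V → V × ℂ`, `x ↦ (b₁ x, b₂ f_h(x))` attached to `b = (b₁, b₂) ∈ ℂ²`. -/
def baseLin (A : MultiArrangement V ι) (h : ι) (b : ℂ × ℂ) : V →ₗ[ℂ] V × ℂ :=
  (b.1 • LinearMap.id).prod (b.2 • A.form h)

theorem baseLin_mem [DecidableEq ι] (A : MultiArrangement V ι) (h : ι) {b : ℂ × ℂ}
    (hb : b ∈ (pencil (A.mult h)).affineComplement) {x : V} (hx : x ∈ A.affineComplement) :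
    A.baseLin h b x ∈ (A.parallelConnection h).affineComplement := by
  have hb' : ∀ j : ℕ, j < A.mult h → b.1 - j * b.2 ≠ 0 := fun j hj => by
    simpa [pencil] using hb ⟨j, hj⟩
  rintro (i | j)
  · have h1 : b.1 ≠ 0 := by simpa using hb' 0 (A.mult_pos h)
    change A.form i (b.1 • x) ≠ 0
    rw [map_smul]
    exact mul_ne_zero h1 (hx i)
  · have h1 := mul_ne_zero (hb' (j + 1) (by omega)) (hx h)
    change A.form h (b.1 • x) - ((j : ℂ) + 1) * (b.2 * A.form h x) ≠ 0
    rw [map_smul, smul_eq_mul]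
    push_cast at h1
    exact fun h0 => h1 (by linear_combination h0)

theorem baseLin_injective (A : MultiArrangement V ι) (h : ι) {b : ℂ × ℂ}
    (hb : b ∈ (pencil (A.mult h)).affineComplement) :
    Function.Injective (A.baseLin h b) := by
  have h1 : b.1 ≠ 0 := by simpa [pencil] using hb ⟨0, A.mult_pos h⟩
  intro x y hxy
  have : b.1 • x = b.1 • y := congrArg Prod.fst hxy
  exact smul_right_injective V h1 this

theorem continuous_projectivization_map {W : Type} [NormedAddCommGroup W] [NormedSpace ℂ W]
    (g : V →ₗ[ℂ] W) (hg : Function.Injective g) (hc : Continuous g) :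
    Continuous (Projectivization.map g hg) :=
  continuous_quot_lift _ (continuous_projectivization_mk (fun v : { v : V // v ≠ 0 } => g v.1)
    (hc.comp continuous_subtype_val) fun v => (map_ne_zero_iff g hg).2 v.2)

theorem map_baseLin_mem [DecidableEq ι] (A : MultiArrangement V ι) (h : ι) {b : ℂ × ℂ}
    (hb : b ∈ (pencil (A.mult h)).affineComplement) {p : ℙ ℂ V} (hp : p ∈ A.projComplement) :
    Projectivization.map (A.baseLin h b) (A.baseLin_injective h hb) p ∈
      (A.parallelConnection h).projComplement := by
  induction p using Projectivization.ind with
  | h x hx =>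
    rw [Projectivization.map_mk, mk_mem_projComplement]
    exact A.baseLin_mem h hb ((A.mk_mem_projComplement _ _).1 hp)

/-- The map `j : X(A) → X(A ∘_{H_h} P_{m_h})`, `[x] ↦ [b₁ x : b₂ f_h(x)]`, determined by the choice
of the base point `[b₁ : b₂]` of `ℙ¹` off the lines of `P_{m_h}`; under the isomorphism
`X(A ∘_{H_h} P_{m_h}) ≅ X(A) × X(P_{m_h})`, `[x : y₂] ↦ ([x], [f_h(x) : y₂])`,
it is the inclusion of the slice `X(A) × {[b₁ : b₂]}`. -/
def baseMap [DecidableEq ι] [FiniteDimensional ℂ V] (A : MultiArrangement V ι) (h : ι)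
    (b : ℂ × ℂ) (hb : b ∈ (pencil (A.mult h)).affineComplement) :
    C(A.projComplement, (A.parallelConnection h).projComplement) where
  toFun p := ⟨Projectivization.map (A.baseLin h b) (A.baseLin_injective h hb) p.1,
    A.map_baseLin_mem h hb p.2⟩
  continuous_toFun := ((continuous_projectivization_map _ _
    (LinearMap.continuous_of_finiteDimensional _)).comp continuous_subtype_val).subtype_mk _

end MultiArrangement

/-- The singular homology group `H_i(X, ℤ)`. -/
abbrev integralHomology (i : ℕ) (X : Type) [TopologicalSpace X] : ModuleCat.{0} ℤ :=
  ((AlgebraicTopology.singularHomologyFunctor (ModuleCat.{0} ℤ) i).obj (ModuleCat.of ℤ ℤ)).obj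
    (TopCat.of X)

end

/-! Write m = ∑ m_ℓ, let F and B be the Milnor fibers of A and of the parallel connection, and put
g(t) = ∏ (1 - j t), 1 ≤ j ≤ m_h - 1. Everything rests on one identity,
`MultiArrangement.parallelConnection_poly`: at (λx, tλ f_h(x)) the new defining polynomial equals
λ^m g(t) Q(x).

For (1), fix t = b₂/b₁ and a λ with λ^m g(t) = 1. The resulting linear map carries F into B, covers
j, and x is recovered from its first coordinate; hence the pullback.

For (2), let (λ, t) run over the curve V: λ^m g(t) = 1. Then F × V → B is the quotient by the m-th
roots of unity ζ, acting by x ↦ ζ⁻¹x and λ ↦ ζλ. A loop e in V gives a map H_i(F) → H_{i+1}(B):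
cross with e and push forward. In the other direction take the transfer to F × V, slant with a class
α in H¹(V, ℤ), and project to F. The composite is ∑_ζ α(ζe)·(ζ⁻¹)_*, which is the identity as soon
as α(ζe) is 1 for ζ = 1 and 0 otherwise. So H_i(F) is a retract of H_{i+1}(B), and the torsion
follows.

Such e and α exist when m_h ≥ 3 (`pencilCurve.exists_edge`): g then vanishes at 1 and 1/2, and a
figure eight around these two points, in opposite directions, lifts to a closed loop in V. The class
α counts crossings of the ray t > 1 on one of its m sheets; e crosses it once there, and the
translates of e cross it on the other sheets.

The retraction already holds on singular chains (`SSet.exists_homology_retract`), with explicit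
transfer, slant and prism operators. -/

noncomputable section

open Limits Opposite Simplicial MonoidalCategory

/-! ### Retracts in homology from degree one maps -/

/-- Degree one maps `s` and `c` between chain complexes which anticommute with the differentials
and satisfy `s ≫ c = 𝟙` exhibit the homology of `L` as a retract of the shifted homology of `K`. -/
theorem ChainComplex.exists_homology_retract {C : Type*} [Category C] [Preadditive C]
    [CategoryWithHomology C] (K L : ChainComplex C ℕ)
    (s : ∀ n, L.X n ⟶ K.X (n + 1)) (c : ∀ n, K.X (n + 1) ⟶ L.X n)
    (hs : ∀ n, s (n + 1) ≫ K.d (n + 2) (n + 1) = -(L.d (n + 1) n ≫ s n))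
    (hc : ∀ n, K.d (n + 2) (n + 1) ≫ c n = -(c (n + 1) ≫ L.d (n + 1) n))
    (h : ∀ n, s n ≫ c n = 𝟙 _) (i : ℕ) :
    ∃ (a : L.homology (i + 1) ⟶ K.homology (i + 2)) (b : K.homology (i + 2) ⟶ L.homology (i + 1)),
      a ≫ b = 𝟙 _ := by
  -- Changing the sign of the middle component turns anticommuting squares into commuting ones.
  let S : L.sc' (i + 2) (i + 1) i ⟶ K.sc' (i + 3) (i + 2) (i + 1) :=
    { τ₁ := s (i + 2)
      τ₂ := -s (i + 1)
      τ₃ := s i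
      comm₁₂ := (hs (i + 1)).trans (Preadditive.comp_neg _ _).symm
      comm₂₃ := (Preadditive.neg_comp _ _).trans (neg_eq_iff_eq_neg.2 (hs i)) }
  let T : K.sc' (i + 3) (i + 2) (i + 1) ⟶ L.sc' (i + 2) (i + 1) i :=
    { τ₁ := c (i + 2)
      τ₂ := -c (i + 1)
      τ₃ := c i
      comm₁₂ := (neg_eq_iff_eq_neg.1 (hc (i + 1)).symm).trans (Preadditive.comp_neg _ _).symm
      comm₂₃ := (Preadditive.neg_comp _ _).trans (hc i).symm }
  have hST : S ≫ T = 𝟙 _ := by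
    ext
    · exact h (i + 2)
    · exact (Preadditive.neg_comp_neg _ _).trans (h (i + 1))
    · exact h i
  let eL := ShortComplex.homologyMapIso (L.isoSc' (i + 2) (i + 1) i (by simp) (by simp))
  let eK := ShortComplex.homologyMapIso (K.isoSc' (i + 3) (i + 2) (i + 1) (by simp) (by simp))
  refine ⟨eL.hom ≫ ShortComplex.homologyMap S ≫ eK.inv,
    eK.hom ≫ ShortComplex.homologyMap T ≫ eL.inv, ?_⟩
  have h1 : ShortComplex.homologyMap S ≫ ShortComplex.homologyMap T = 𝟙 _ := by
    rw [← ShortComplex.homologyMap_comp, hST, ShortComplex.homologyMap_id]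
  have h2 : eL.hom ≫ (ShortComplex.homologyMap S ≫ (eK.inv ≫ eK.hom) ≫ ShortComplex.homologyMap T) ≫
      eL.inv = 𝟙 _ := by
    rw [Iso.inv_hom_id, Category.id_comp, h1, Category.id_comp, Iso.hom_inv_id]
  simp only [Category.assoc] at h2
  exact ((Category.assoc _ _ _).trans (congrArg _ (Category.assoc _ _ _))).trans h2

/-- Linear maps preserve torsion, so the retraction `b`, split by `a`, restricts to a split
surjection. -/
theorem exists_surjective_torsion {M N : ModuleCat.{0} ℤ} (a : M ⟶ N) (b : N ⟶ M)
    (h : a ≫ b = 𝟙 _) :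
    ∃ ψ : Submodule.torsion ℤ N →+ Submodule.torsion ℤ M, Function.Surjective ψ := by
  have map_tor : ∀ {P Q : ModuleCat.{0} ℤ} (f : P ⟶ Q) (x : P), x ∈ Submodule.torsion ℤ P →
      f.hom x ∈ Submodule.torsion ℤ Q := by
    rintro P Q f x ⟨r, hr⟩
    exact ⟨r, (f.hom.map_smul' (r : ℤ) x).symm.trans ((congrArg f.hom hr).trans (map_zero f.hom))⟩
  refine ⟨((b.hom.restrict (map_tor b)).toAddMonoidHom), fun x => ⟨⟨a.hom x, map_tor a _ x.2⟩, ?_⟩⟩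
  apply Subtype.ext
  exact congrArg (fun f : M ⟶ M => f.hom x.1) h

namespace SSet

variable {C : Type*} [Category C] [Preadditive C] [HasCoproducts.{0} C]

/-! ### Transfer for finite group quotients of simplicial sets -/

section transfer

variable {E B : SSet.{0}} {G : Type} [Group G] [Fintype G]

/-- The transfer of a map of simplicial sets that identifies the orbits of a finite group. -/
theorem exists_transfer (p : E ⟶ B) (a : G → (E ⟶ E)) (ha : ∀ g h, a g ≫ a h = a (h * g))
    (hsurj : ∀ (n : ℕ) (x : B _⦋n⦌), ∃ y : E _⦋n⦌, p.app _ y = x)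
    (horb : ∀ (n : ℕ) (y z : E _⦋n⦌), p.app _ y = p.app _ z → ∃ g, z = (a g).app _ y) (R : C) :
    ∃ t : B.chainComplex R ⟶ E.chainComplex R, ∀ (n : ℕ) (y : E _⦋n⦌),
      B.ιChainComplex (p.app _ y) ≫ t.f n = ∑ g, E.ιChainComplex ((a g).app _ y) := by
  choose l hl using hsurj
  -- The orbit sum does not depend on the lift. This is needed because a face of a chosen lift need
  -- not be the chosen lift of the face.
  have key : ∀ (n : ℕ) (y z : E _⦋n⦌), p.app _ y = p.app _ z →
      (∑ g, E.ιChainComplex (R := R) ((a g).app _ y)) =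
        ∑ g, E.ιChainComplex (R := R) ((a g).app _ z) := by
    intro n y z h
    obtain ⟨g, rfl⟩ := horb n y z h
    symm
    refine Fintype.sum_equiv (Equiv.mulRight g) _ _ fun k => ?_
    have := ha g k
    simp [← this]
  let t (n : ℕ) : (B.chainComplex R).X n ⟶ (E.chainComplex R).X n :=
    Sigma.desc fun x : B _⦋n⦌ => ∑ g, E.ιChainComplex ((a g).app _ (l n x))
  have ht : ∀ (n : ℕ) (x : B _⦋n⦌),
      B.ιChainComplex x ≫ t n = ∑ g, E.ιChainComplex ((a g).app _ (l n x)) :=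
    fun n x => Sigma.ι_desc _ _
  refine ⟨ChainComplex.ofHom t fun n => ?_, fun n y => ?_⟩
  · refine SSet.chainComplex_hom_ext fun x => ?_
    rw [← Category.assoc, ← Category.assoc, ht, ιChainComplex_d, Preadditive.sum_comp,
      Preadditive.sum_comp]
    simp only [ιChainComplex_d, Preadditive.zsmul_comp, ht]
    rw [Finset.sum_comm]
    refine Finset.sum_congr rfl fun i _ => ?_
    rw [← Finset.smul_sum]
    congr 1
    rw [← key n (E.δ i (l (n + 1) x)) (l n (B.δ i x))
      (by rw [hl, δ_naturality_apply, hl])]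
    refine Finset.sum_congr rfl fun g _ => ?_
    rw [δ_naturality_apply]
  · refine (ht n _).trans (key n _ _ ?_)
    rw [hl]

end transfer

/-! ### Slant product with a 1-cocycle -/

section slant

variable {E F : SSet.{0}}

/-- The edge of an `n + 1`-simplex joining its first two vertices. -/
abbrev firstEdge (E : SSet.{0}) {n : ℕ} (y : E _⦋n + 1⦌) : E _⦋1⦌ :=
  E.map (SimplexCategory.mkOfLe (n := n + 1) 0 1 (Fin.zero_le _)).op y

theorem firstEdge_δ_add_two {n : ℕ} (y : E _⦋n + 2⦌) (i : Fin (n + 1)) :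
    E.firstEdge (E.δ i.succ.succ y) = E.firstEdge y := by
  simp only [firstEdge, SimplicialObject.δ, ← Functor.map_comp_apply, ← op_comp]
  congr 3
  exact congrArg Quiver.Hom.op (SimplexCategory.Hom.ext_one_left _ _)

/-- The cocycle identity on the triangle spanned by the first three vertices. It makes the terms of
faces 0 and 1 combine in the boundary formula for the slant product. -/
theorem cocycle_firstEdge (α : E _⦋1⦌ → ℤ)
    (hα : ∀ y : E _⦋2⦌, α (E.δ 1 y) = α (E.δ 2 y) + α (E.δ 0 y))
    {n : ℕ} (y : E _⦋n + 2⦌) :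
    α (E.firstEdge (E.δ 1 y)) = α (E.firstEdge y) + α (E.firstEdge (E.δ 0 y)) := by
  have h := hα (E.map (SimplexCategory.mkOfLeComp (n := n + 2) 0 1 2 (Fin.zero_le _)
    (by change 1 ≤ 2 % (n + 3); rw [Nat.mod_eq_of_lt (by omega)]; omega)).op y)
  simp only [firstEdge, SimplicialObject.δ, ← Functor.map_comp_apply, ← op_comp] at h ⊢
  have e (f g : ⦋1⦌ ⟶ ⦋n + 2⦌) (h0 : f 0 = g 0) (h1 : f 1 = g 1) :
      E.map f.op y = E.map g.op y := by
    rw [SimplexCategory.Hom.ext_one_left f g h0 h1]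
  have two : (2 : Fin (n + 3)) = Fin.succ 1 := rfl
  refine Eq.trans (congrArg α (e _ _ ?_ ?_)) (h.trans (congrArg₂ (· + ·) (congrArg α (e _ _ ?_ ?_))
    (congrArg α (e _ _ ?_ ?_))))
  all_goals rfl

/-- The slant product of a map of simplicial sets with a `1`-cocycle. -/
theorem exists_slant (q : E ⟶ F) (α : E _⦋1⦌ → ℤ)
    (hα : ∀ y : E _⦋2⦌, α (E.δ 1 y) = α (E.δ 2 y) + α (E.δ 0 y)) (R : C) :
    ∃ c : ∀ n, (E.chainComplex R).X (n + 1) ⟶ (F.chainComplex R).X n,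
      (∀ n (y : E _⦋n + 1⦌), E.ιChainComplex y ≫ c n =
        α (E.firstEdge y) • F.ιChainComplex (q.app _ (E.δ 0 y))) ∧
      ∀ n, (E.chainComplex R).d (n + 2) (n + 1) ≫ c n =
        -(c (n + 1) ≫ (F.chainComplex R).d (n + 1) n) := by
  let c (n : ℕ) : (E.chainComplex R).X (n + 1) ⟶ (F.chainComplex R).X n :=
    Sigma.desc fun y : E _⦋n + 1⦌ => α (E.firstEdge y) • F.ιChainComplex (q.app _ (E.δ 0 y))
  have hc : ∀ n (y : E _⦋n + 1⦌), E.ιChainComplex y ≫ c n =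
      α (E.firstEdge y) • F.ιChainComplex (q.app _ (E.δ 0 y)) := fun n y => Sigma.ι_desc _ _
  refine ⟨c, hc, fun n => SSet.chainComplex_hom_ext fun y => ?_⟩
  rw [← Category.assoc, ιChainComplex_d, Preadditive.sum_comp, Preadditive.comp_neg,
    ← Category.assoc, hc, Preadditive.zsmul_comp, ιChainComplex_d, Fin.sum_univ_succ,
    Fin.sum_univ_succ, Fin.sum_univ_succ (n := n + 1)]
  simp only [Preadditive.zsmul_comp, hc, firstEdge_δ_add_two]
  have h0 : E.δ 0 (E.δ 1 y) = E.δ 0 (E.δ 0 y) :=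
    (ConcreteCategory.congr_hom (E.δ_comp_δ (n := n) (i := 0) (j := 0) le_rfl) y)
  have h2 (k : Fin (n + 1)) : E.δ 0 (E.δ k.succ.succ y) = E.δ k.succ (E.δ 0 y) :=
    (ConcreteCategory.congr_hom (E.δ_comp_δ (n := n) (i := 0) (j := k.succ) (Fin.zero_le _)) y)
  have h1 := cocycle_firstEdge α hα y
  rw [Fin.succ_zero_eq_one, h0, h1]
  simp only [h2, ← δ_naturality_apply, Fin.val_succ, Fin.val_zero, Fin.val_one, pow_succ, pow_zero,
    mul_neg, mul_one, neg_neg, neg_smul, one_smul, add_smul, smul_add, Finset.smul_sum,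
    Finset.sum_neg_distrib, smul_neg]
  simp only [smul_comm (α (E.firstEdge y))]
  abel

end slant

/-! ### Prism operator of a loop of maps -/

section prism

variable {F E : SSet.{0}}

/-- The prism operator is a chain homotopy between the two ends of `H`; as these agree, it
anticommutes with the differentials. Geometrically it is the cross product with the loop. -/
theorem exists_prism (H : F ⊗ Δ[1] ⟶ E) (h01 : (ι₀ : F ⟶ F ⊗ Δ[1]) ≫ H = ι₁ ≫ H) (R : C) :
    ∃ S : ∀ n, (F.chainComplex R).X n ⟶ (E.chainComplex R).X (n + 1),
      (∀ n (x : F _⦋n⦌), F.ιChainComplex x ≫ S n =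
        ∑ k : Fin (n + 1), (-1 : ℤ) ^ (k : ℕ) •
          E.ιChainComplex (H.app _ (F.σ k x, stdSimplex.objMk₁ k.succ.castSucc))) ∧
      ∀ n, S (n + 1) ≫ (E.chainComplex R).d (n + 2) (n + 1) =
        -((F.chainComplex R).d (n + 1) n ≫ S n) := by
  let Hs : SSet.Homotopy (ι₀ ≫ H) (ι₀ ≫ H) :=
    { h := H, h₀ := rfl, h₁ := h01.symm, rel := by ext n x; exact x.1.2.elim }
  let P := Hs.toSimplicialObjectHomotopy
  let Q := P.sSetChainComplexMap R
  -- The chain homotopy attached to a simplicial homotopy carries a global minus sign, removed here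
  -- so that the prism with `k = 0` has coefficient 1.
  refine ⟨fun n => -Q.hom n (n + 1), fun n x => ?_, fun n => ?_⟩
  · have : -Q.hom n (n + 1) =
        ∑ k : Fin (n + 1), (-1 : ℤ) ^ (k : ℕ) • ((sigmaConst.obj R).map (P.h k)) :=
      (congrArg Neg.neg (SimplicialObject.Homotopy.ToChainHomotopy.hom_eq
        (P.whiskerRight (sigmaConst.obj R)) n)).trans (neg_neg _)
    refine (congrArg (F.ιChainComplex x ≫ ·) this).trans ?_
    refine (Preadditive.comp_sum _ _ _).trans (Finset.sum_congr rfl fun k _ => ?_)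
    refine (Preadditive.comp_zsmul _ _ _).trans (congrArg _ ?_)
    refine (Sigma.ι_comp_map' _ _ _).trans ?_
    exact Category.id_comp _
  · have := Q.comm (n + 1)
    rw [dNext_eq (i' := n) (w := by simp), prevD_eq (j' := n + 2) (w := by simp),
      right_eq_add] at this
    simp only [Preadditive.neg_comp, Preadditive.comp_neg, neg_neg]
    exact neg_eq_iff_add_eq_zero.2 ((add_comm _ _).trans this)

/-- In the prism with `k = 0` the first edge runs along the interval, over the first vertex of `x`;
only here can the cocycle see the loop. -/
theorem exists_firstEdge_prism_zero (H : F ⊗ Δ[1] ⟶ E) {n : ℕ} (x : F _⦋n⦌) :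
    ∃ x₀ : F _⦋0⦌, E.firstEdge (H.app (op ⦋n + 1⦌) (F.σ 0 x, stdSimplex.objMk₁ 1)) =
      H.app _ (F.σ 0 x₀, stdSimplex.objMk₁ 1) := by
  refine ⟨F.map (SimplexCategory.const ⦋0⦌ ⦋n⦌ 0).op x, ?_⟩
  refine (NatTrans.naturality_apply H _ _).symm.trans (congrArg _ ?_)
  refine Prod.ext ?_ ?_
  · change F.map _ (F.map _ x) = F.map _ (F.map _ x)
    simp only [← Functor.map_comp_apply, ← op_comp]
    congr 3
    exact congrArg Quiver.Hom.op (SimplexCategory.Hom.ext_one_left _ _)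
  · refine stdSimplex.ext _ _ (Fin.forall_fin_two.2 ⟨rfl, ?_⟩)
    rfl

/-- In the other prisms the first two vertices both lie over the start of the interval, so the slant
product will kill them. -/
theorem exists_firstEdge_prism_succ (H : F ⊗ Δ[1] ⟶ E) {n : ℕ} (x : F _⦋n + 1⦌) (k : Fin (n + 1)) :
    ∃ y : F _⦋1⦌, E.firstEdge (H.app (op ⦋n + 2⦌)
      (F.σ k.succ x, stdSimplex.objMk₁ k.succ.succ.castSucc)) = (ι₀ ≫ H).app _ y := by
  refine ⟨F.firstEdge (F.σ k.succ x), ?_⟩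
  refine (NatTrans.naturality_apply H _ _).symm.trans (congrArg _ ?_)
  refine Prod.ext rfl ?_
  refine stdSimplex.ext _ _ (Fin.forall_fin_two.2 ⟨rfl, ?_⟩)
  rfl

theorem face_prism_zero (H : F ⊗ Δ[1] ⟶ E) {n : ℕ} (x : F _⦋n⦌) :
    E.δ 0 (H.app (op ⦋n + 1⦌) (F.σ 0 x, stdSimplex.objMk₁ 1)) = (ι₁ ≫ H).app _ x := by
  refine (δ_naturality_apply H _ _).symm.trans (congrArg _ ?_)
  refine Prod.ext ?_ ?_
  · exact ConcreteCategory.congr_hom (F.δ_comp_σ_self (n := n) (i := 0)) x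
  · exact (stdSimplex.δ_objMk₁_of_lt _ _ (by simp)).trans rfl

end prism

/-! ### The chain-level retraction -/

section main

variable {F E B : SSet.{0}} {G : Type} [Group G] [Fintype G]

/-- A loop of self-homotopies of a section-like map `F ⟶ E` on which the cocycle `α` takes the value
`1` exhibits the homology of `F` as a retract of the shifted homology of `B`. -/
theorem exists_homology_retract [CategoryWithHomology C] (p : E ⟶ B) (a : G → (E ⟶ E))
    (ha : ∀ g h, a g ≫ a h = a (h * g))
    (hsurj : ∀ (n : ℕ) (x : B _⦋n⦌), ∃ y : E _⦋n⦌, p.app _ y = x)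
    (horb : ∀ (n : ℕ) (y z : E _⦋n⦌), p.app _ y = p.app _ z → ∃ g, z = (a g).app _ y)
    (q : E ⟶ F) (α : E _⦋1⦌ → ℤ)
    (hα : ∀ y : E _⦋2⦌, α (E.δ 1 y) = α (E.δ 2 y) + α (E.δ 0 y))
    (H : F ⊗ Δ[1] ⟶ E) (h01 : (ι₀ : F ⟶ F ⊗ Δ[1]) ≫ H = ι₁ ≫ H)
    (hq : ι₁ ≫ H ≫ a 1 ≫ q = 𝟙 F)
    (hconst : ∀ (g : G) (x : F _⦋1⦌), α ((a g).app _ ((ι₀ ≫ H).app _ x)) = 0)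
    (hone : ∀ x : F _⦋0⦌, α ((a 1).app _ (H.app _ (F.σ 0 x, stdSimplex.objMk₁ 1))) = 1)
    (hne : ∀ (g : G), g ≠ 1 → ∀ x : F _⦋0⦌,
      α ((a g).app _ (H.app _ (F.σ 0 x, stdSimplex.objMk₁ 1))) = 0)
    (R : C) (i : ℕ) :
    ∃ (u : F.homology R (i + 1) ⟶ B.homology R (i + 2))
      (v : B.homology R (i + 2) ⟶ F.homology R (i + 1)), u ≫ v = 𝟙 _ := by
  obtain ⟨t, ht⟩ := exists_transfer p a ha hsurj horb R
  obtain ⟨c, hc, hcd⟩ := exists_slant q α hα R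
  obtain ⟨S, hS, hSd⟩ := exists_prism H h01 R
  have edge_map : ∀ (g : G) n (y : E _⦋n + 1⦌),
      E.firstEdge ((a g).app _ y) = (a g).app _ (E.firstEdge y) :=
    fun g n y => ((a g).naturality_apply _ _).symm
  -- Among the translates of the `k = 0` prism only `g = 1` survives, and its face opposite the
  -- first vertex projects back to `x`.
  have hP0 : ∀ n (x : F _⦋n⦌),
      (∑ g, E.ιChainComplex ((a g).app _ (H.app (op ⦋n + 1⦌) (F.σ 0 x, stdSimplex.objMk₁ 1)))) ≫
        c n =
      F.ιChainComplex (R := R) x := by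
    intro n x
    obtain ⟨x₀, hx₀⟩ := exists_firstEdge_prism_zero H x
    rw [Preadditive.sum_comp, Finset.sum_eq_single 1]
    · rw [hc, edge_map, hx₀, hone, one_smul, ← δ_naturality_apply, face_prism_zero]
      exact congrArg _ (ConcreteCategory.congr_hom (NatTrans.congr_app hq (op ⦋n⦌)) x)
    · intro g _ hg
      rw [hc, edge_map, hx₀, hne g hg, zero_smul]
    · simp
  have hPs : ∀ n (x : F _⦋n + 1⦌) (k : Fin (n + 1)),
      (∑ g, E.ιChainComplex ((a g).app _ (H.app (op ⦋n + 2⦌)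
        (F.σ k.succ x, stdSimplex.objMk₁ k.succ.succ.castSucc)))) ≫ c (n + 1) =
        (0 : R ⟶ (F.chainComplex R).X (n + 1)) := by
    intro n x k
    obtain ⟨y, hy⟩ := exists_firstEdge_prism_succ H x k
    rw [Preadditive.sum_comp]
    refine Finset.sum_eq_zero fun g _ => ?_
    rw [hc, edge_map, hy, hconst, zero_smul]
  refine ChainComplex.exists_homology_retract _ _
    (fun n => S n ≫ (chainComplexMap p R).f (n + 1)) (fun n => t.f (n + 1) ≫ c n)
    (fun n => ?_) (fun n => ?_) (fun n => SSet.chainComplex_hom_ext fun x => ?_) i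
  · rw [Category.assoc, HomologicalComplex.Hom.comm, ← Category.assoc, hSd,
      Preadditive.neg_comp, Category.assoc]
  · rw [← Category.assoc, ← HomologicalComplex.Hom.comm, Category.assoc, hcd,
      Preadditive.comp_neg, Category.assoc]
  · have h1 : ∀ y : E _⦋n + 1⦌, E.ιChainComplex y ≫ (chainComplexMap p R).f (n + 1) ≫
        t.f (n + 1) ≫ c n = (∑ g, E.ιChainComplex ((a g).app _ y)) ≫ c n := fun y => by
      rw [← Category.assoc, ι_chainComplexMap_f, ← Category.assoc, ht]
    rw [Category.comp_id, Category.assoc, ← Category.assoc, hS, Preadditive.sum_comp]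
    simp only [Preadditive.zsmul_comp, h1]
    rw [Fin.sum_univ_succ]
    refine (congrArg₂ (· + ·) ((one_smul ℤ _).trans (hP0 n x)) ?_).trans (add_zero _)
    obtain _ | n := n
    · simp
    · exact Finset.sum_eq_zero fun k _ => by rw [hPs, smul_zero]

end main

end SSet

end

/-! ### Continuous logarithms and the winding cocycle -/

noncomputable section

open Limits Opposite Simplicial MonoidalCategory

theorem IsPreconnected.eq_of_countable_range {X Y : Type*} [TopologicalSpace X] [MetricSpace Y]
    {s : Set X} (hs : IsPreconnected s) {f : X → Y} (hf : ContinuousOn f s) {t : Set Y}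
    (ht : t.Countable) (hft : ∀ x ∈ s, f x ∈ t) {x y : X} (hx : x ∈ s) (hy : y ∈ s) : f x = f y :=
  ht.isTotallyDisconnected (f '' s) (Set.image_subset_iff.2 hft) (hs.image f hf)
    (Set.mem_image_of_mem f hx) (Set.mem_image_of_mem f hy)

theorem IsPreconnected.eq_of_pow_eq_one {X : Type*} [TopologicalSpace X] {s : Set X}
    (hs : IsPreconnected s) {f : X → ℂ} (hf : ContinuousOn f s) {m : ℕ} (hm : 0 < m)
    (h : ∀ x ∈ s, f x ^ m = 1) {x y : X} (hx : x ∈ s) (hy : y ∈ s) : f x = f y := by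
  refine hs.eq_of_countable_range hf (t := ((Polynomial.nthRoots m (1 : ℂ)).toFinset : Set ℂ))
    (Finset.countable_toSet _) (fun z hz => ?_) hx hy
  simpa [Polynomial.mem_nthRoots hm] using h z hz

theorem IsPreconnected.sub_eq_of_exp_eq {X : Type*} [TopologicalSpace X] {s : Set X}
    (hs : IsPreconnected s) {f g : X → ℂ} (hf : ContinuousOn f s) (hg : ContinuousOn g s)
    (h : ∀ x ∈ s, Complex.exp (f x) = Complex.exp (g x)) {x y : X} (hx : x ∈ s) (hy : y ∈ s) :
    f x - f y = g x - g y := by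
  have := hs.eq_of_countable_range (hf.sub hg)
    (t := Set.range fun n : ℤ => (n : ℂ) * (2 * Real.pi * Complex.I))
    (Set.countable_range _) (fun z hz => ?_) hx hy
  · simp only [Pi.sub_apply] at this
    linear_combination this
  · obtain ⟨n, hn⟩ := Complex.exp_eq_exp_iff_exists_int.1 (h z hz)
    exact ⟨n, by simp [hn]⟩

/-- A nowhere vanishing function on a contractible space has a continuous logarithm. -/
theorem exists_continuous_log {X : Type*} [TopologicalSpace X] [ContractibleSpace X] (f : C(X, ℂ))
    (hf : ∀ x, f x ≠ 0) : ∃ L : C(X, ℂ), ∀ x, Complex.exp (L x) = f x := by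
  obtain ⟨x₀, ⟨K⟩⟩ := id_nullhomotopic X
  let f' : C(X, {z : ℂ // z ≠ 0}) := ⟨fun x => ⟨f x, hf x⟩, by fun_prop⟩
  -- The contraction run backwards: a homotopy from the constant `f x₀`, which has a logarithm, to
  -- `f`. Lifting it through `exp` ends in a logarithm of `f`.
  let H : C(unitInterval × X, {z : ℂ // z ≠ 0}) := f'.comp K.symm.toContinuousMap
  have hH : ∀ x, H (0, x) =
      (fun z : ℂ ↦ (⟨_, z.exp_ne_zero⟩ : {z : ℂ // z ≠ 0}))
      (ContinuousMap.const X (Complex.log (f x₀)) x) := by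
    intro x
    apply Subtype.ext
    simp [H, f', Complex.exp_log (hf x₀)]
  refine ⟨(Complex.isCoveringMap_exp.liftHomotopy H
    (ContinuousMap.const X (Complex.log (f x₀))) hH).comp
    ⟨fun x => (1, x), by fun_prop⟩, fun x => ?_⟩
  have := congrArg Subtype.val
    (congrFun (Complex.isCoveringMap_exp.liftHomotopy_lifts H _ hH) (1, x))
  refine this.trans ?_
  simp [H, f']

/-- The change of a continuous logarithm of `f` from `a` to `b`, compared with the principal
logarithm, in units of `2πi`. -/
def windingNumber {X : Type*} [TopologicalSpace X] (f : C(X, ℂ)) (a b : X) : ℤ :=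
  Classical.epsilon fun n : ℤ => ∀ L : C(X, ℂ), (∀ x, Complex.exp (L x) = f x) →
    L b - L a = Complex.log (f b) - Complex.log (f a) + n * (2 * Real.pi * Complex.I)

/-- Two logarithms of `f` differ by a constant on a preconnected space, so one integer serves them
all. -/
theorem windingNumber_spec {X : Type*} [TopologicalSpace X] [PreconnectedSpace X] {f : C(X, ℂ)}
    (L : C(X, ℂ)) (hL : ∀ x, Complex.exp (L x) = f x) (a b : X) :
    L b - L a = Complex.log (f b) - Complex.log (f a) +
      windingNumber f a b * (2 * Real.pi * Complex.I) := by
  refine Classical.epsilon_spec (p := fun n : ℤ => ∀ L : C(X, ℂ),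
    (∀ x, Complex.exp (L x) = f x) → L b - L a = Complex.log (f b) - Complex.log (f a) +
      n * (2 * Real.pi * Complex.I)) ?_ L hL
  have h (x : X) : ∃ k : ℤ, L x = Complex.log (f x) + k * (2 * Real.pi * Complex.I) :=
    Complex.exp_eq_exp_iff_exists_int.1
      ((hL x).trans (Complex.exp_log (hL x ▸ Complex.exp_ne_zero _)).symm)
  obtain ⟨k, hk⟩ := h a
  obtain ⟨l, hl⟩ := h b
  refine ⟨l - k, fun L' hL' => ?_⟩
  have := isPreconnected_univ.sub_eq_of_exp_eq L.continuous.continuousOn L'.continuous.continuousOn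
    (fun x _ => (hL x).trans (hL' x).symm) (Set.mem_univ b) (Set.mem_univ a)
  rw [← this, hk, hl]
  push_cast
  ring

instance contractibleSpace_toTop (n : SimplexCategory) :
    ContractibleSpace (SimplexCategory.toTop.{0}.obj n) := by
  have : ContractibleSpace (stdSimplex ℝ (Fin (n.len + 1))) :=
    (convex_stdSimplex ℝ _).contractibleSpace ⟨_, single_mem_stdSimplex ℝ 0⟩
  exact (Homeomorph.ulift (X := stdSimplex ℝ (Fin (n.len + 1)))).contractibleSpace

namespace TopCat

/-- The `i`-th vertex of the topological `n`-simplex. -/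
def vertex {n : ℕ} (i : Fin (n + 1)) : SimplexCategory.toTop.{0}.obj ⦋n⦌ :=
  SimplexCategory.toTop.map (SimplexCategory.const ⦋0⦌ ⦋n⦌ i) default

theorem map_vertex {n k : ℕ} (φ : ⦋n⦌ ⟶ ⦋k⦌) (i : Fin (n + 1)) :
    SimplexCategory.toTop.map φ (vertex i) = vertex (φ i) := by
  simp only [vertex, ← Functor.map_comp_apply]
  rfl

/-- The continuous map underlying a singular simplex. -/
def simplexMap {V : TopCat.{0}} {n : ℕ} (y : (toSSet.obj V) _⦋n⦌) :
    C(SimplexCategory.toTop.{0}.obj ⦋n⦌, V) :=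
  Hom.hom y.down

/-- The `1`-cochain which assigns to a singular `1`-simplex the change of the argument of `θ` along
it, compared with the principal argument at its end points. -/
def windingCochain {V : TopCat.{0}} (θ : C(V, ℂ)) (y : (toSSet.obj V) _⦋1⦌) : ℤ :=
  windingNumber (θ.comp (simplexMap y)) (vertex 0) (vertex 1)

theorem windingCochain_spec {V : TopCat.{0}} {θ : C(V, ℂ)} {n : ℕ} (y : (toSSet.obj V) _⦋n⦌)
    (L : C(SimplexCategory.toTop.{0}.obj ⦋n⦌, ℂ)) (hL : ∀ x, Complex.exp (L x) = θ (simplexMap y x))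
    (φ : ⦋1⦌ ⟶ ⦋n⦌) :
    L (vertex (φ 1)) - L (vertex (φ 0)) = Complex.log (θ (simplexMap y (vertex (φ 1)))) -
      Complex.log (θ (simplexMap y (vertex (φ 0)))) +
      windingCochain θ ((toSSet.obj V).map φ.op y) * (2 * Real.pi * Complex.I) := by
  have := windingNumber_spec (f := θ.comp (simplexMap ((toSSet.obj V).map φ.op y)))
    (L.comp (Hom.hom (SimplexCategory.toTop.map φ))) (fun x => hL _) (vertex 0) (vertex 1)
  rw [← map_vertex, ← map_vertex]
  exact this

/-- One logarithm `L` on the whole triangle computes all three edges: the changes of `L` and of the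
principal logarithm at the vertices both add up along edges. -/
theorem windingCochain_cocycle {V : TopCat.{0}} {θ : C(V, ℂ)} (hθ : ∀ v, θ v ≠ 0)
    (y : (toSSet.obj V) _⦋2⦌) :
    windingCochain θ ((toSSet.obj V).δ 1 y) =
      windingCochain θ ((toSSet.obj V).δ 2 y) + windingCochain θ ((toSSet.obj V).δ 0 y) := by
  obtain ⟨L, hL⟩ := exists_continuous_log (θ.comp (simplexMap y)) (fun x => hθ _)
  have h0 := windingCochain_spec y L hL (SimplexCategory.δ 0)
  have h1 := windingCochain_spec y L hL (SimplexCategory.δ 1)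
  have h2 := windingCochain_spec y L hL (SimplexCategory.δ 2)
  have h : ((windingCochain θ ((toSSet.obj V).δ 1 y) : ℤ) : ℂ) * (2 * Real.pi * Complex.I) =
      ((windingCochain θ ((toSSet.obj V).δ 2 y) +
        windingCochain θ ((toSSet.obj V).δ 0 y) : ℤ) : ℂ) * (2 * Real.pi * Complex.I) := by
    have e00 : (SimplexCategory.δ (0 : Fin 3)) (0 : Fin 2) = (1 : Fin 3) := rfl
    have e01 : (SimplexCategory.δ (0 : Fin 3)) (1 : Fin 2) = (2 : Fin 3) := rfl
    have e10 : (SimplexCategory.δ (1 : Fin 3)) (0 : Fin 2) = (0 : Fin 3) := rfl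
    have e11 : (SimplexCategory.δ (1 : Fin 3)) (1 : Fin 2) = (2 : Fin 3) := rfl
    have e20 : (SimplexCategory.δ (2 : Fin 3)) (0 : Fin 2) = (0 : Fin 3) := rfl
    have e21 : (SimplexCategory.δ (2 : Fin 3)) (1 : Fin 2) = (1 : Fin 3) := rfl
    rw [e00, e01] at h0
    rw [e10, e11] at h1
    rw [e20, e21] at h2
    push_cast
    simp only [SimplicialObject.δ]
    linear_combination h2 + h0 - h1
  exact_mod_cast mul_right_cancel₀ Complex.two_pi_I_ne_zero h

theorem windingCochain_of_closed {V : TopCat.{0}} {θ : C(V, ℂ)} (y : (toSSet.obj V) _⦋1⦌)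
    (hy : simplexMap y (vertex 0) = simplexMap y (vertex 1))
    (L : C(SimplexCategory.toTop.{0}.obj ⦋1⦌, ℂ)) (hL : ∀ x, Complex.exp (L x) = θ (simplexMap y x))
    (k : ℤ) (hk : L (vertex 1) - L (vertex 0) = k * (2 * Real.pi * Complex.I)) :
    windingCochain θ y = k := by
  have h := windingNumber_spec (f := θ.comp (simplexMap y)) L hL (vertex 0) (vertex 1)
  have h' : (k : ℂ) * (2 * Real.pi * Complex.I) =
      (windingCochain θ y : ℂ) * (2 * Real.pi * Complex.I) := by
    rw [← hk, h]
    change Complex.log (θ (simplexMap y _)) - Complex.log (θ (simplexMap y _)) + _ = _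
    rw [hy, sub_self, zero_add]
    rfl
  exact_mod_cast (mul_right_cancel₀ Complex.two_pi_I_ne_zero h').symm

end TopCat

end

/-! ### The retraction for a quotient of a product of spaces -/

noncomputable section

open Limits Opposite Simplicial MonoidalCategory

namespace TopCat

theorem map_const_apply {n k : ℕ} (i : Fin (k + 1)) (x : SimplexCategory.toTop.{0}.obj ⦋n⦌) :
    SimplexCategory.toTop.map (SimplexCategory.const ⦋n⦌ ⦋k⦌ i) x = vertex i := by
  rw [show SimplexCategory.const ⦋n⦌ ⦋k⦌ i =
    SimplexCategory.const ⦋n⦌ ⦋0⦌ 0 ≫ SimplexCategory.const ⦋0⦌ ⦋k⦌ i from rfl,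
    Functor.map_comp_apply]
  exact congrArg _ (Subsingleton.elim _ _)

/-- The map of singular simplicial sets induced by a continuous map on a product. -/
def toSSetProdMap {F V B : TopCat.{0}} (p : C(F × V, B)) :
    toSSet.obj F ⊗ toSSet.obj V ⟶ toSSet.obj B where
  app _ := TypeCat.ofHom fun y => ⟨ofHom (p.comp (y.1.down.hom.prodMk y.2.down.hom))⟩
  naturality _ _ _ := rfl

/-- The singular simplex with underlying continuous map `f`. -/
def ofSimplexMap {V : TopCat.{0}} {n : ℕ} (f : C(SimplexCategory.toTop.{0}.obj ⦋n⦌, V)) :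
    (toSSet.obj V) _⦋n⦌ :=
  ⟨ofHom f⟩

variable {F V B : TopCat.{0}} {G : Type} [CommGroup G] [Fintype G]

/-- Singular simplices have contractible domains, so `hsurj` and `horb` say exactly that the
singular set of `B` is the orbit set of that of `F × V`. The loop of maps is x ↦ (x, e(·)), and the
cocycle is the winding of `θ` on the second factor. -/
theorem exists_homology_retract (p : C(F × V, B)) (aF : G → C(F, F)) (aV : G → C(V, V))
    (hF : ∀ g h, (aF h).comp (aF g) = aF (h * g)) (hF1 : aF 1 = ContinuousMap.id _)
    (hV : ∀ g h, (aV h).comp (aV g) = aV (h * g)) (hV1 : aV 1 = ContinuousMap.id _)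
    (hsurj : ∀ (T : Type) [TopologicalSpace T] [ContractibleSpace T] (f : C(T, B)),
      ∃ (x : C(T, F)) (v : C(T, V)), ∀ t, p (x t, v t) = f t)
    (horb : ∀ (T : Type) [TopologicalSpace T] [ContractibleSpace T] (x x' : C(T, F))
      (v v' : C(T, V)), (∀ t, p (x t, v t) = p (x' t, v' t)) →
        ∃ g, ∀ t, x' t = aF g (x t) ∧ v' t = aV g (v t))
    (θ : C(V, ℂ)) (hθ : ∀ v, θ v ≠ 0) (e : C(SimplexCategory.toTop.{0}.obj ⦋1⦌, V))
    (he : e (vertex 0) = e (vertex 1))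
    (hone : windingCochain θ (ofSimplexMap e) = 1)
    (hne : ∀ g, g ≠ 1 → windingCochain θ (ofSimplexMap ((aV g).comp e)) = 0) (i : ℕ) :
    ∃ (u : integralHomology (i + 1) F ⟶ integralHomology (i + 2) B)
      (v : integralHomology (i + 2) B ⟶ integralHomology (i + 1) F), u ≫ v = 𝟙 _ := by
  let a (g : G) : toSSet.obj F ⊗ toSSet.obj V ⟶ toSSet.obj F ⊗ toSSet.obj V :=
    toSSet.map (ofHom (aF g)) ⊗ₘ toSSet.map (ofHom (aV g))
  let L : Δ[1] ⟶ toSSet.obj V := SSet.yonedaEquiv.symm (ofSimplexMap e)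
  have hL : ∀ (n : ℕ) (φ : ⦋n⦌ ⟶ ⦋1⦌), L.app (op ⦋n⦌) (SSet.stdSimplex.objEquiv.symm φ) =
      ofSimplexMap (e.comp (SimplexCategory.toTop.map φ).hom) := fun n φ => rfl
  have hL1 : L.app (op ⦋1⦌) (SSet.stdSimplex.objMk₁ 1) = ofSimplexMap e := by
    have : (SSet.stdSimplex.objMk₁ 1 : (Δ[1] _⦋1⦌ : Type)) = SSet.stdSimplex.objEquiv.symm (𝟙 _) :=
      SSet.stdSimplex.ext _ _ (Fin.forall_fin_two.2 ⟨rfl, rfl⟩)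
    rw [this, hL, CategoryTheory.Functor.map_id]
    rfl
  have hvert (k : Fin 2) : L.app (op ⦋0⦌) (SSet.stdSimplex.obj₀Equiv.symm k) =
      ofSimplexMap (ContinuousMap.const _ (e (vertex k))) := by
    refine (hL 0 (SimplexCategory.const ⦋0⦌ ⦋1⦌ k)).trans ?_
    exact congrArg ofSimplexMap (ContinuousMap.ext fun t => congrArg e (map_const_apply k t))
  have hconst : (SSet.const (SSet.stdSimplex.obj₀Equiv.symm 0) : toSSet.obj F ⟶ Δ[1]) ≫ L =
      SSet.const (SSet.stdSimplex.obj₀Equiv.symm 1) ≫ L := by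
    rw [SSet.const_comp, SSet.const_comp, hvert, hvert, he]
  refine SSet.exists_homology_retract (toSSetProdMap p) a (fun g h => ?_) (fun n f => ?_)
    (fun n y z hyz => ?_) (SemiCartesianMonoidalCategory.fst _ _) (fun y => windingCochain θ y.2)
    (fun y => windingCochain_cocycle hθ y.2) (toSSet.obj F ◁ L) ?_ ?_ (fun g x => ?_) (fun x => ?_)
    (fun g hg x => ?_) (ModuleCat.of ℤ ℤ) i
  · refine NatTrans.ext (funext fun n => ?_)
    ext y
    refine Prod.ext ?_ ?_
    · exact congrArg (fun f => ULift.up (y.1.down ≫ ofHom f)) (hF g h)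
    · exact congrArg (fun f => ULift.up (y.2.down ≫ ofHom f)) (hV g h)
  · obtain ⟨x, v, h⟩ := hsurj _ (simplexMap f)
    refine ⟨(ofSimplexMap x, ofSimplexMap v), ?_⟩
    exact congrArg (fun f => ULift.up (ofHom f)) (ContinuousMap.ext h)
  · obtain ⟨g, hg⟩ := horb _ (simplexMap y.1) (simplexMap z.1) (simplexMap y.2) (simplexMap z.2)
      (fun t => congrArg (fun f : (toSSet.obj B) _⦋n⦌ => simplexMap f t) hyz)
    refine ⟨g, Prod.ext ?_ ?_⟩
    · exact congrArg (fun f => ULift.up (ofHom f)) (ContinuousMap.ext fun t => (hg t).1)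
    · exact congrArg (fun f => ULift.up (ofHom f)) (ContinuousMap.ext fun t => (hg t).2)
  · apply CartesianMonoidalCategory.hom_ext
    · simp
    · simpa using hconst
  · refine NatTrans.ext (funext fun n => ?_)
    ext y
    exact congrArg (fun f => ULift.up (y.down ≫ ofHom f)) hF1
  -- At the start of the interval the second coordinate is a constant path, on which a constant
  -- logarithm is available.
  · have h : ∀ t, simplexMap ((a g).app _ ((SSet.ι₀ ≫ toSSet.obj F ◁ L).app _ x)).2 t =
        aV g (e (vertex 0)) := fun t =>
      congrArg (fun t => aV g (e t)) (map_const_apply (n := 1) (k := 1) 0 t)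
    refine windingCochain_of_closed _ ((h _).trans (h _).symm)
      (ContinuousMap.const _ (Complex.log (θ (aV g (e (vertex 0)))))) (fun t => ?_) 0 (by simp)
    rw [h]
    exact Complex.exp_log (hθ _)
  · have h : ((a 1).app _ ((toSSet.obj F ◁ L).app _
        ((toSSet.obj F).σ 0 x, SSet.stdSimplex.objMk₁ 1))).2 = ofSimplexMap e :=
      (congrArg (fun f => (toSSet.map (ofHom f)).app _ (L.app _ (SSet.stdSimplex.objMk₁ 1)))
        hV1).trans hL1
    rw [h, hone]
  · have h : ((a g).app _ ((toSSet.obj F ◁ L).app _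
        ((toSSet.obj F).σ 0 x, SSet.stdSimplex.objMk₁ 1))).2 = ofSimplexMap ((aV g).comp e) :=
      congrArg (fun f => (toSSet.map (ofHom (aV g))).app _ f) hL1
    rw [h, hne g hg]

end TopCat

end

/-! ### The polynomial of the parallel connection and the pullback square -/

noncomputable section

open Limits Opposite Simplicial MonoidalCategory

namespace MultiArrangement

variable {V ι : Type} [NormedAddCommGroup V] [NormedSpace ℂ V]

/-- The degree `∑ i, m_i` of the defining polynomial. -/
def degree [Fintype ι] (A : MultiArrangement V ι) : ℕ := ∑ i, A.mult i

theorem degree_pos [Fintype ι] [Nonempty ι] (A : MultiArrangement V ι) : 0 < A.degree :=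
  Finset.sum_pos (fun i _ => A.mult_pos i) Finset.univ_nonempty

theorem poly_smul [Fintype ι] (A : MultiArrangement V ι) (c : ℂ) (x : V) :
    A.poly (c • x) = c ^ A.degree * A.poly x := by
  simp [poly, degree, mul_pow, Finset.prod_mul_distrib, Finset.prod_pow_eq_pow_sum]

/-- The polynomial `∏ j = 1, …, k - 1, (1 - j t)`. -/
def pencilPoly (k : ℕ) (t : ℂ) : ℂ := ∏ j : Fin (k - 1), (1 - ((j : ℂ) + 1) * t)

theorem continuous_pencilPoly (k : ℕ) : Continuous (pencilPoly k) := by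
  unfold pencilPoly
  fun_prop

/-- Each of the m_h - 1 new factors at this point is λ f_h(x) (1 - j t); together with the remaining
factor f_h they restore the power f_h ^ m_h of Q. -/
theorem parallelConnection_poly [Fintype ι] [DecidableEq ι] (A : MultiArrangement V ι) (h : ι)
    (x : V) (l t : ℂ) : (A.parallelConnection h).poly (l • x, t * (l * A.form h x)) =
      l ^ A.degree * pencilPoly (A.mult h) t * A.poly x := by
  have h1 : (A.parallelConnection h).poly (l • x, t * (l * A.form h x)) =
      (∏ i, A.form i (l • x) ^ Function.update A.mult h 1 i) *
        ∏ j : Fin (A.mult h - 1), ((l * A.form h x) * (1 - ((j : ℂ) + 1) * t)) := by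
    simp only [poly, Fintype.prod_sum_type]
    congr 1
    refine Finset.prod_congr rfl fun j _ => ?_
    change (A.form h (l • x) - ((j : ℂ) + 1) * (t * (l * A.form h x))) ^ 1 = _
    rw [map_smul, smul_eq_mul, pow_one]
    ring
  have h2 : (∏ i, A.form i (l • x) ^ Function.update A.mult h 1 i) =
      (l * A.form h x) * ∏ i ∈ Finset.univ.erase h, A.form i (l • x) ^ A.mult i := by
    rw [← Finset.mul_prod_erase _ _ (Finset.mem_univ h), Function.update_self, pow_one, map_smul,
      smul_eq_mul]
    congr 1
    refine Finset.prod_congr rfl fun i hi => ?_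
    rw [Function.update_of_ne (Finset.ne_of_mem_erase hi)]
  have h3 : A.poly (l • x) = (l * A.form h x) ^ A.mult h *
      ∏ i ∈ Finset.univ.erase h, A.form i (l • x) ^ A.mult i := by
    rw [poly, ← Finset.mul_prod_erase _ _ (Finset.mem_univ h), map_smul, smul_eq_mul]
  have h4 : (l * A.form h x) ^ A.mult h = l * A.form h x * (l * A.form h x) ^ (A.mult h - 1) := by
    rw [← pow_succ', Nat.sub_add_cancel (A.mult_pos h)]
  rw [h1, h2, Finset.prod_mul_distrib, Finset.prod_const, Finset.card_univ, Fintype.card_fin,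
    mul_right_comm _ (pencilPoly _ _), ← poly_smul, h3, h4, pencilPoly]
  ring

theorem pencilPoly_ne_zero {k : ℕ} {b : ℂ × ℂ} (hk : 0 < k) (hb : b ∈ (pencil k).affineComplement) :
    b.1 ≠ 0 ∧ pencilPoly k (b.2 / b.1) ≠ 0 := by
  have hb' : ∀ j : ℕ, j < k → b.1 - j * b.2 ≠ 0 := fun j hj => by
    simpa [pencil] using hb ⟨j, hj⟩
  have h1 : b.1 ≠ 0 := by simpa using hb' 0 hk
  refine ⟨h1, Finset.prod_ne_zero_iff.2 fun j _ h0 => hb' (j + 1) (by omega) ?_⟩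
  field_simp at h0
  push_cast
  linear_combination h0

theorem exists_pullback_square [Fintype ι] [DecidableEq ι] [Nonempty ι] [FiniteDimensional ℂ V]
    (A : MultiArrangement V ι) (h : ι) (b : ℂ × ℂ)
    (hb : b ∈ (pencil (A.mult h)).affineComplement) :
    ∃ φ : C(A.milnorFiber, (A.parallelConnection h).milnorFiber),
      (∀ (x y : A.milnorFiber) (ζ : ℂ), (y : V) = ζ • (x : V) →
        (φ y : V × ℂ) = ζ • (φ x : V × ℂ)) ∧
      IsPullback (TopCat.ofHom φ) (TopCat.ofHom A.milnorCover)
        (TopCat.ofHom (A.parallelConnection h).milnorCover) (TopCat.ofHom (A.baseMap h b hb)) := by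
  obtain ⟨hb1, hg⟩ := pencilPoly_ne_zero (A.mult_pos h) hb
  -- Rescaling by this root cancels the factor g(b₂/b₁), so the slice map carries Milnor fiber to
  -- Milnor fiber.
  obtain ⟨l, hl⟩ := IsAlgClosed.exists_pow_nat_eq (pencilPoly (A.mult h) (b.2 / b.1))⁻¹ A.degree_pos
  have hl0 : l ≠ 0 := by
    rintro rfl
    rw [zero_pow A.degree_pos.ne'] at hl
    exact inv_ne_zero hg hl.symm
  have hQ (x : V) : (A.parallelConnection h).poly ((l / b.1) • A.baseLin h b x) = A.poly x := by
    have := A.parallelConnection_poly h x l (b.2 / b.1)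
    rw [hl, inv_mul_cancel₀ hg, one_mul] at this
    rw [← this]
    congr 1
    refine Prod.ext ?_ ?_
    · change (l / b.1) • b.1 • x = l • x
      rw [smul_smul, div_mul_cancel₀ _ hb1]
    · change (l / b.1) * (b.2 * A.form h x) = b.2 / b.1 * (l * A.form h x)
      ring
  have hc0 : l / b.1 ≠ 0 := div_ne_zero hl0 hb1
  let φ : C(A.milnorFiber, (A.parallelConnection h).milnorFiber) :=
    { toFun := fun x => ⟨(l / b.1) • A.baseLin h b x.1, (hQ x.1).trans x.2⟩
      continuous_toFun := (((A.baseLin h b).continuous_of_finiteDimensional.comp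
        continuous_subtype_val).const_smul (l / b.1)).subtype_mk _ }
  have hφinj : Function.Injective φ := fun x y hxy =>
    Subtype.ext (A.baseLin_injective h hb (smul_right_injective _ hc0 (congrArg Subtype.val hxy)))
  have hw : ∀ x, (A.parallelConnection h).milnorCover (φ x) =
      A.baseMap h b hb (A.milnorCover x) := by
    intro x
    refine Subtype.ext ?_
    exact (Projectivization.mk_eq_mk_iff' ℂ _ _ _ _).2 ⟨l / b.1, rfl⟩
  -- A point of the new fiber over the slice is a multiple of (b₁x₀, b₂f_h(x₀)); its first
  -- coordinate divided by `l` is the preimage, a formula continuous in `z`.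
  have hlift : ∀ (z : (A.parallelConnection h).milnorFiber) (p : A.projComplement),
      (A.parallelConnection h).milnorCover z = A.baseMap h b hb p →
      ∃ hx : l⁻¹ • z.1.1 ∈ A.milnorFiber, φ ⟨_, hx⟩ = z ∧ A.milnorCover ⟨_, hx⟩ = p := by
    rintro z ⟨p, hp⟩ hzp
    induction p using Projectivization.ind with
    | h x₀ hx₀ =>
      obtain ⟨a, ha⟩ := (Projectivization.mk_eq_mk_iff' ℂ _ _ _ _).1 (congrArg Subtype.val hzp)
      have h1 : l⁻¹ • z.1.1 = (l⁻¹ * a * b.1) • x₀ := by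
        rw [← ha]
        change l⁻¹ • a • b.1 • x₀ = _
        rw [smul_smul, smul_smul]
      have h2 : (l / b.1) • A.baseLin h b (l⁻¹ • z.1.1) = z.1 := by
        rw [h1, map_smul, smul_smul, ← ha]
        congr 1
        field_simp
      have hx : l⁻¹ • z.1.1 ∈ A.milnorFiber := by
        change A.poly _ = 1
        rw [← hQ, h2]
        exact z.2
      refine ⟨hx, Subtype.ext h2, Subtype.ext ?_⟩
      exact (Projectivization.mk_eq_mk_iff' ℂ _ _ _ _).2 ⟨l⁻¹ * a * b.1, h1.symm⟩
  refine ⟨φ, fun x y ζ hxy => ?_, ⟨⟨?_⟩, ⟨PullbackCone.IsLimit.mk _ (fun s => TopCat.ofHom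
    ⟨fun t => ⟨l⁻¹ • (s.fst t).1.1,
      (hlift _ _ (ConcreteCategory.congr_hom s.condition t)).1⟩, ?_⟩) ?_ ?_ ?_⟩⟩⟩
  · change (l / b.1) • A.baseLin h b y.1 = ζ • (l / b.1) • A.baseLin h b x.1
    rw [hxy, map_smul, smul_comm]
  · exact TopCat.hom_ext (ContinuousMap.ext hw)
  · have : Continuous fun t => s.fst t := s.fst.hom.continuous
    exact Continuous.subtype_mk (by fun_prop) _
  · exact fun s => TopCat.hom_ext (ContinuousMap.ext fun t =>
      (hlift _ _ (ConcreteCategory.congr_hom s.condition t)).2.1)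
  · exact fun s => TopCat.hom_ext (ContinuousMap.ext fun t =>
      (hlift _ _ (ConcreteCategory.congr_hom s.condition t)).2.2)
  · refine fun s f hf _ => TopCat.hom_ext (ContinuousMap.ext fun t => hφinj ?_)
    exact (ConcreteCategory.congr_hom hf t).trans
      (hlift _ _ (ConcreteCategory.congr_hom s.condition t)).2.1.symm

end MultiArrangement

end

/-! ### The curve λ^m g(t) = 1: sheets, the cut and the loop -/

noncomputable section

/-- The plane curve `λ ^ m * ∏ j = 1, …, k - 1, (1 - j t) = 1`. -/
def pencilCurve (k m : ℕ) : Set (ℂ × ℂ) :=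
  {v | v.1 ^ m * MultiArrangement.pencilPoly k v.2 = 1}

namespace pencilCurve

open MultiArrangement

variable {k m : ℕ}

theorem pencilPoly_ne_zero (v : pencilCurve k m) : pencilPoly k v.1.2 ≠ 0 :=
  right_ne_zero_of_mul_eq_one v.2

theorem factor_ne_zero (v : pencilCurve k m) (j : Fin (k - 1)) : 1 - ((j : ℂ) + 1) * v.1.2 ≠ 0 :=
  Finset.prod_ne_zero_iff.1 (pencilPoly_ne_zero v) j (Finset.mem_univ j)

theorem fst_ne_zero (hm : 0 < m) (v : pencilCurve k m) : v.1.1 ≠ 0 := fun h => by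
  have := v.2
  simp [pencilCurve, h, hm.ne'] at this

/-- The ratio of `λ` and a branch of the `m`-th root of `1 / ∏ (1 - j t)` on `1 ≤ Re t`. -/
def sheet (m : ℕ) (v : pencilCurve k m) : ℂ :=
  v.1.1 * Complex.exp ((∑ j : Fin (k - 1),
    (Complex.log (((j : ℂ) + 1) * v.1.2 - 1) + Real.pi * Complex.I)) / m)

theorem sheet_pow (hm : 0 < m) (v : pencilCurve k m) : sheet m v ^ m = 1 := by
  have hm' : (m : ℂ) ≠ 0 := by exact_mod_cast hm.ne'
  rw [sheet, mul_pow, ← Complex.exp_nat_mul, mul_div_cancel₀ _ hm', Complex.exp_sum]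
  refine Eq.trans ?_ v.2
  congr 1
  refine Finset.prod_congr rfl fun j _ => ?_
  have h : ((j : ℂ) + 1) * v.1.2 - 1 ≠ 0 := fun h => factor_ne_zero v j (by linear_combination -h)
  rw [Complex.exp_add, Complex.exp_log h, Complex.exp_pi_mul_I]
  ring

/-- For Re t ≥ 1 each (j + 1) t - 1 is nonzero with nonnegative real part, hence stays off the
branch cut of the logarithm. The values being m-th roots of unity, `sheet` is locally constant
there. -/
theorem continuousOn_sheet : ContinuousOn (sheet (k := k) m) {v | 1 ≤ v.1.2.re} := by
  refine ContinuousOn.mul (by fun_prop) (Complex.continuous_exp.comp_continuousOn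
    (ContinuousOn.div_const (continuousOn_finsetSum _ fun j _ => ?_) _))
  refine ContinuousOn.add (ContinuousOn.clog (by fun_prop) fun v hv => ?_) continuousOn_const
  have hv' : 1 ≤ v.1.2.re := hv
  have hre : (((j : ℂ) + 1) * v.1.2 - 1).re = ((j : ℝ) + 1) * v.1.2.re - 1 := by simp
  have hj : (0 : ℝ) ≤ (j : ℕ) := Nat.cast_nonneg _
  have h0 : 0 ≤ (((j : ℂ) + 1) * v.1.2 - 1).re := by
    rw [hre]; nlinarith
  rcases h0.lt_or_eq with h | h
  · exact Or.inl h
  · refine Or.inr fun him => factor_ne_zero v j ?_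
    have : ((j : ℂ) + 1) * v.1.2 - 1 = 0 := Complex.ext h.symm him
    linear_combination -this

theorem sub_one_ne_zero (hk : 3 ≤ k) (v : pencilCurve k m) : v.1.2 - 1 ≠ 0 := fun h =>
  factor_ne_zero v ⟨0, by omega⟩ (by simp; linear_combination -h)

open Classical in
/-- A function on the curve which winds once around the origin when the preimage of the ray
`1 < t` is crossed on one sheet, and is constant on the other sheets. -/
def cut (k m : ℕ) (v : pencilCurve k m) : ℂ :=
  if 1 ≤ v.1.2.re ∧ sheet m v = 1 then -((v.1.2 - 1) / (starRingEnd ℂ) (v.1.2 - 1)) else 1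

theorem neg_div_conj_of_re_eq_zero {z : ℂ} (hz : z ≠ 0) (h : z.re = 0) :
    -(z / (starRingEnd ℂ) z) = 1 := by
  have : (starRingEnd ℂ) z = -z := Complex.ext (by simp [h]) (by simp)
  rw [this, div_neg, div_self hz, neg_neg]

theorem cut_ne_zero (hk : 3 ≤ k) (v : pencilCurve k m) : cut k m v ≠ 0 := by
  unfold cut
  split_ifs
  · exact neg_ne_zero.2 (div_ne_zero (sub_one_ne_zero hk v)
      ((map_ne_zero _).2 (sub_one_ne_zero hk v)))
  · exact one_ne_zero

/-- The two formulas agree on Re t = 1, where t - 1 is imaginary. The frontier of the chosen region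
lies there, because the sheet is open and closed in the preimage of Re t > 1. -/
theorem continuous_cut (hk : 3 ≤ k) (hm : 0 < m) : Continuous (cut k m) := by
  unfold cut
  have hclosed : IsClosed {v : pencilCurve k m | 1 ≤ v.1.2.re ∧ sheet m v = 1} :=
    continuousOn_sheet.preimage_isClosed_of_isClosed
      (isClosed_le continuous_const (by fun_prop)) isClosed_singleton
  have hopen : IsOpen {v : pencilCurve k m | 1 < v.1.2.re ∧ sheet m v = 1} := by
    have hU : IsOpen {v : pencilCurve k m | 1 < v.1.2.re} :=
      isOpen_lt continuous_const (by fun_prop)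
    have hsub : {v : pencilCurve k m | 1 < v.1.2.re} ⊆ {v | 1 ≤ v.1.2.re} :=
      fun v (hv : 1 < v.1.2.re) => hv.le
    have h := (continuousOn_sheet.mono hsub).isOpen_inter_preimage hU
      ((Polynomial.nthRoots m (1 : ℂ)).toFinset.erase 1).finite_toSet.isClosed.isOpen_compl
    convert h using 1
    ext v
    have := sheet_pow hm v
    simp [Polynomial.mem_nthRoots hm, this]
  refine continuous_if (fun v hv => ?_) (Continuous.continuousOn ?_) continuousOn_const
  · have hv1 := hclosed.frontier_subset hv
    refine neg_div_conj_of_re_eq_zero (sub_one_ne_zero hk v) ?_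
    rw [Complex.sub_re, Complex.one_re, sub_eq_zero]
    refine (hv1.1.eq_or_lt.resolve_right fun hlt => hv.2 ?_).symm
    have hsub : {v : pencilCurve k m | 1 < v.1.2.re ∧ sheet m v = 1} ⊆
        {v : pencilCurve k m | 1 ≤ v.1.2.re ∧ sheet m v = 1} := fun w hw => ⟨hw.1.le, hw.2⟩
    exact interior_maximal hsub hopen ⟨hlt, hv1.2⟩
  · exact (Continuous.div (by fun_prop) (by fun_prop)
      fun v => (map_ne_zero _).2 (sub_one_ne_zero hk v)).neg

/-- A figure eight around the points `1/2` and `1`. -/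
def figureEight (c y : ℝ) : ℂ := 3 / 4 + c * (1 / 3 + y * Complex.I)

/-- The lift closes up because g along the figure eight factors through a nonvanishing function of
(cos s, sin s) defined on the whole plane; its logarithm there is automatically 2π-periodic in s. -/
theorem exists_loop (hk : 3 ≤ k) (hm : 0 < m) : ∃ γ : C(ℝ, pencilCurve k m),
    (∀ s, (γ s).1.2 = figureEight (Real.cos s) (Real.sin s)) ∧
    γ (-Real.pi) = γ Real.pi ∧ sheet m (γ 0) = 1 := by
  obtain ⟨r, hr⟩ : ∃ r, k - 1 = r + 2 := ⟨k - 3, by omega⟩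
  let clamp (c : ℝ) : ℝ := max (-1) (min c 1)
  -- The leading factor is (1 - t)(1 - 2t) = 2((t - 3/4)² - 1/16) with cos² replaced by 1 - sin²,
  -- which removes its zeros off the circle. Clamping keeps Re t ≥ 3/4 - 1/3 = 5/12 > 1/3, away from
  -- the roots 1/3, 1/4, ….
  let D : C(ℝ × ℝ, ℂ) := ⟨fun p => 2 * ((1 - p.2 ^ 2) * (1 / 3 + p.2 * Complex.I) ^ 2 - 1 / 16) *
    ∏ j : Fin r, (1 - ((j : ℂ) + 3) * figureEight (clamp p.1) p.2), by
      unfold figureEight clamp; fun_prop⟩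
  have hD : ∀ p, D p ≠ 0 := by
    rintro ⟨c, y⟩
    refine mul_ne_zero (mul_ne_zero two_ne_zero fun h => ?_)
      (Finset.prod_ne_zero_iff.2 fun j _ h => ?_)
    · have h0 : (1 - (y : ℂ) ^ 2) * (1 / 3 + y * Complex.I) ^ 2 - 1 / 16 =
          (((1 - y ^ 2) * (1 / 9 - y ^ 2) - 1 / 16 : ℝ) : ℂ) +
            ((2 / 3 * ((1 - y ^ 2) * y) : ℝ) : ℂ) * Complex.I := by
        push_cast
        linear_combination (1 - (y : ℂ) ^ 2) * y ^ 2 * Complex.I_sq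
      rw [h0] at h
      have h1 : (1 - y ^ 2) * (1 / 9 - y ^ 2) - 1 / 16 = 0 := by
        simpa only [Complex.re_add_im, Complex.add_re, Complex.ofReal_re, Complex.re_ofReal_mul,
          Complex.I_re, mul_zero, add_zero, Complex.zero_re] using congrArg Complex.re h
      have h2 : 2 / 3 * ((1 - y ^ 2) * y) = 0 := by
        simpa only [Complex.add_im, Complex.ofReal_im, Complex.im_ofReal_mul, Complex.I_im,
          mul_one, zero_add, Complex.zero_im] using congrArg Complex.im h
      replace h2 := (mul_eq_zero.1 h2).resolve_left (by norm_num)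
      rcases mul_eq_zero.1 h2 with h3 | h3
      · rw [h3] at h1; norm_num at h1
      · rw [h3] at h1; norm_num at h1
    · have h1 : 1 - ((j : ℝ) + 3) * (3 / 4 + clamp c / 3) = 0 := by
        have h0 : 1 - ((j : ℂ) + 3) * figureEight (clamp c) y =
            ((1 - ((j : ℝ) + 3) * (3 / 4 + clamp c / 3) : ℝ) : ℂ) +
              ((-((j : ℝ) + 3) * clamp c * y : ℝ) : ℂ) * Complex.I := by
          unfold figureEight
          push_cast
          ring
        have h' := h0.symm.trans h
        simpa only [Complex.add_re, Complex.ofReal_re, Complex.re_ofReal_mul,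
          Complex.I_re, mul_zero, add_zero, Complex.zero_re] using congrArg Complex.re h'
      have h2 : -1 ≤ clamp c := le_max_left _ _
      have hj : (0 : ℝ) ≤ (j : ℕ) := Nat.cast_nonneg _
      nlinarith
  obtain ⟨L, hL⟩ := exists_continuous_log D hD
  have hm' : (m : ℂ) ≠ 0 := by exact_mod_cast hm.ne'
  have hclamp (s : ℝ) : clamp (Real.cos s) = Real.cos s := by
    simp only [clamp]
    rw [min_eq_left (Real.cos_le_one s), max_eq_right (Real.neg_one_le_cos s)]
  have hg (s : ℝ) : pencilPoly k (figureEight (Real.cos s) (Real.sin s)) =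
      D (Real.cos s, Real.sin s) := by
    have h1 : pencilPoly k (figureEight (Real.cos s) (Real.sin s)) = ∏ j : Fin (r + 2),
        (1 - ((j : ℂ) + 1) * figureEight (Real.cos s) (Real.sin s)) := by
      rw [pencilPoly, hr]
    rw [h1, Fin.prod_univ_succ, Fin.prod_univ_succ]
    have h2 : D (Real.cos s, Real.sin s) = 2 * ((1 - (Real.sin s : ℂ) ^ 2) *
        (1 / 3 + Real.sin s * Complex.I) ^ 2 - 1 / 16) *
          ∏ j : Fin r, (1 - ((j : ℂ) + 3) * figureEight (clamp (Real.cos s)) (Real.sin s)) := rfl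
    rw [h2, ← mul_assoc, hclamp]
    congr 1
    · have h3 : (Real.cos s : ℂ) ^ 2 + (Real.sin s : ℂ) ^ 2 = 1 := by
        exact_mod_cast Real.cos_sq_add_sin_sq s
      simp only [figureEight, Fin.val_zero, Fin.val_succ, Nat.cast_zero, Nat.cast_add, Nat.cast_one]
      linear_combination (2 * (1 / 3 + (Real.sin s : ℂ) * Complex.I) ^ 2) * h3
    · refine Finset.prod_congr rfl fun j _ => ?_
      push_cast [Fin.val_succ]
      ring
  let l (s : ℝ) : ℂ := Complex.exp (-L (Real.cos s, Real.sin s) / m)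
  have hl (s : ℝ) : l s ^ m * pencilPoly k (figureEight (Real.cos s) (Real.sin s)) = 1 := by
    rw [hg, ← hL, ← Complex.exp_nat_mul, mul_div_cancel₀ _ hm', ← Complex.exp_add, neg_add_cancel,
      Complex.exp_zero]
  -- Dividing by this root of unity puts the lift on sheet 1 at s = 0.
  let ζ : ℂ := sheet m (⟨(l 0, figureEight (Real.cos 0) (Real.sin 0)), hl 0⟩ : pencilCurve k m)
  have hζ : ζ ^ m = 1 := sheet_pow hm _
  refine ⟨⟨fun s => ⟨(ζ⁻¹ * l s, figureEight (Real.cos s) (Real.sin s)), ?_⟩, ?_⟩, fun s => rfl,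
    ?_, ?_⟩
  · change (ζ⁻¹ * l s) ^ m * _ = 1
    rw [mul_pow, inv_pow, hζ, inv_one, one_mul, hl]
  · have : Continuous l := by fun_prop
    unfold figureEight
    fun_prop
  · refine Subtype.ext (Prod.ext ?_ ?_)
    · change ζ⁻¹ * l (-Real.pi) = ζ⁻¹ * l Real.pi
      simp [l]
    · simp
  · change ζ⁻¹ * l 0 * _ = 1
    rw [mul_assoc]
    exact inv_mul_cancel₀ fun h => by simp [h, hm.ne'] at hζ

end pencilCurve

end

/-! ### Winding of the cut function along the loop and its translates -/

noncomputable section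

theorem Complex.exp_two_arg_mul_I {z : ℂ} (hz : z ≠ 0) :
    Complex.exp (2 * z.arg * Complex.I) = z / (starRingEnd ℂ) z := by
  have hn : (‖z‖ : ℂ) ≠ 0 := by exact_mod_cast norm_ne_zero_iff.2 hz
  have h1 : Complex.exp (z.arg * Complex.I) = z / ‖z‖ := by
    rw [eq_div_iff hn, mul_comm, Complex.norm_mul_exp_arg_mul_I]
  have h2 : (‖z‖ : ℂ) ^ 2 = z * (starRingEnd ℂ) z := (Complex.mul_conj' z).symm
  have hc : (starRingEnd ℂ) z ≠ 0 := (map_ne_zero _).2 hz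
  rw [show (2 * z.arg * Complex.I : ℂ) = z.arg * Complex.I + z.arg * Complex.I by ring,
    Complex.exp_add, h1, div_mul_div_comm, ← pow_two, ← pow_two, h2]
  field_simp

namespace pencilCurve

variable {k m : ℕ}

theorem one_le_re_figureEight_iff {s : ℝ} (hs : |s| ≤ Real.pi) :
    1 ≤ (figureEight (Real.cos s) (Real.sin s)).re ↔ |s| ≤ Real.arccos (3 / 4) := by
  have hre : (figureEight (Real.cos s) (Real.sin s)).re = 3 / 4 + Real.cos s / 3 := by
    simp [figureEight, -Complex.ofReal_cos, -Complex.ofReal_sin]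
    norm_num
    ring
  have hcos : Real.cos (Real.arccos (3 / 4)) = 3 / 4 := Real.cos_arccos (by norm_num) (by norm_num)
  have h0 := Real.arccos_nonneg (3 / 4)
  have hpi := Real.arccos_le_pi (3 / 4)
  rw [hre, ← Real.strictAntiOn_cos.le_iff_ge ⟨h0, hpi⟩ ⟨abs_nonneg s, hs⟩, hcos, Real.cos_abs]
  constructor <;> intro h <;> linarith

/-- The action of the `m`-th roots of unity on the curve. -/
def rotate (m : ℕ) (g : rootsOfUnity m ℂ) : C(pencilCurve k m, pencilCurve k m) where
  toFun v := ⟨((g : ℂˣ) * v.1.1, v.1.2), by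
    have hg : ((g : ℂˣ) : ℂ) ^ m = 1 := (mem_rootsOfUnity' m _).1 g.2
    change ((g : ℂˣ) * v.1.1) ^ m * _ = 1
    rw [mul_pow, hg, one_mul]
    exact v.2⟩
  continuous_toFun := by fun_prop

theorem sheet_rotate (g : rootsOfUnity m ℂ) (v : pencilCurve k m) :
    sheet m (rotate m g v) = (g : ℂˣ) * sheet m v :=
  mul_assoc _ _ _

/-- The arc |s| ≤ arccos (3/4) is the part of the loop in Re t ≥ 1; it is connected and meets sheet
1 at s = 0, so translation by `g` moves all of it to sheet `g`. -/
theorem sheet_rotate_loop (hm : 0 < m) {γ : C(ℝ, pencilCurve k m)}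
    (h2 : ∀ s, (γ s).1.2 = figureEight (Real.cos s) (Real.sin s)) (h0 : sheet m (γ 0) = 1)
    (g : rootsOfUnity m ℂ) {s : ℝ} (hs : |s| ≤ Real.arccos (3 / 4)) :
    sheet m (rotate m g (γ s)) = (g : ℂˣ) := by
  have hcont : ContinuousOn (fun s => sheet m (γ s))
      (Set.Icc (-Real.arccos (3 / 4)) (Real.arccos (3 / 4))) := by
    refine continuousOn_sheet.comp γ.continuous.continuousOn fun t ht => ?_
    change 1 ≤ (γ t).1.2.re
    rw [h2, one_le_re_figureEight_iff ((abs_le.2 ht).trans (Real.arccos_le_pi _))]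
    exact abs_le.2 ht
  have := isPreconnected_Icc.eq_of_pow_eq_one hcont hm (fun t _ => sheet_pow hm _)
    (abs_le.1 hs) (y := 0) (by simp [Real.arccos_nonneg])
  rw [sheet_rotate, this, h0, mul_one]

/-- A nontrivial translate never meets sheet 1 over Re t ≥ 1, so `cut` is identically 1 along it. -/
theorem log_loop_of_ne_one (hm : 0 < m) {γ : C(ℝ, pencilCurve k m)}
    (h2 : ∀ s, (γ s).1.2 = figureEight (Real.cos s) (Real.sin s)) (h0 : sheet m (γ 0) = 1)
    {g : rootsOfUnity m ℂ} (hg : g ≠ 1) (l : C(ℝ, ℂ))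
    (hl : ∀ s, Complex.exp (l s) = cut k m (rotate m g (γ s))) :
    l Real.pi - l (-Real.pi) = 0 := by
  have := isPreconnected_Icc.sub_eq_of_exp_eq (s := Set.Icc (-Real.pi) Real.pi)
    l.continuous.continuousOn (continuousOn_const (c := 0)) (fun s hs => ?_)
    (x := Real.pi) (y := -Real.pi) (by simp [Real.pi_nonneg]) (by simp [Real.pi_nonneg])
  · simpa using this
  · rw [hl, Complex.exp_zero, cut, if_neg]
    rintro ⟨h3, h4⟩
    change 1 ≤ (γ s).1.2.re at h3
    rw [h2, one_le_re_figureEight_iff (abs_le.2 hs)] at h3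
    rw [sheet_rotate_loop hm h2 h0 g h3] at h4
    exact hg (Subtype.ext (Units.ext h4))

theorem log_loop_one (hk : 3 ≤ k) (hm : 0 < m) {γ : C(ℝ, pencilCurve k m)}
    (h2 : ∀ s, (γ s).1.2 = figureEight (Real.cos s) (Real.sin s)) (h0 : sheet m (γ 0) = 1)
    (l : C(ℝ, ℂ)) (hl : ∀ s, Complex.exp (l s) = cut k m (γ s)) :
    l Real.pi - l (-Real.pi) = 2 * Real.pi * Complex.I := by
  set s₀ := Real.arccos (3 / 4) with hs₀
  have hs0 : 0 < s₀ := Real.arccos_pos.2 (by norm_num)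
  have hpi : s₀ < Real.pi := by
    rw [hs₀, ← Real.arccos_neg_one]
    exact Real.strictAntiOn_arccos ⟨le_rfl, by norm_num⟩ ⟨by norm_num, by norm_num⟩ (by norm_num)
  have hcos : Real.cos s₀ = 3 / 4 := Real.cos_arccos (by norm_num) (by norm_num)
  have hsin : 0 < Real.sin s₀ := Real.sin_pos_of_pos_of_lt_pi hs0 hpi
  let z (s : ℝ) : ℂ := figureEight (Real.cos s) (Real.sin s) - 1
  have hre (s : ℝ) : (z s).re = Real.cos s / 3 - 1 / 4 := by
    simp [z, figureEight, -Complex.ofReal_cos, -Complex.ofReal_sin]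
    norm_num
    ring
  have him (s : ℝ) : (z s).im = Real.cos s * Real.sin s := by
    simp [z, figureEight, -Complex.ofReal_cos, -Complex.ofReal_sin]
  have hz (s : ℝ) : z s ≠ 0 := by
    have := sub_one_ne_zero hk (γ s)
    rwa [h2] at this
  have hcut (s : ℝ) (hs : |s| ≤ s₀) : cut k m (γ s) = -(z s / (starRingEnd ℂ) (z s)) := by
    have h1 : 1 ≤ (γ s).1.2.re := by
      rw [h2]; exact (one_le_re_figureEight_iff (hs.trans hpi.le)).2 hs
    have h3 := sheet_rotate_loop hm h2 h0 1 hs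
    rw [sheet_rotate] at h3
    rw [cut, if_pos ⟨h1, by simpa using h3⟩, h2]
  have hcut' (s : ℝ) (hs : s₀ ≤ |s|) (hs' : |s| ≤ Real.pi) : cut k m (γ s) = 1 := by
    rcases hs.eq_or_lt with h | h
    · rw [hcut s h.symm.le]
      refine neg_div_conj_of_re_eq_zero (hz s) ?_
      rw [hre, ← Real.cos_abs, ← h, hcos]
      norm_num
    · rw [cut, if_neg]
      rintro ⟨h1, -⟩
      rw [h2, one_le_re_figureEight_iff hs'] at h1
      exact absurd h1 h.not_ge
  have hright : l Real.pi - l s₀ = 0 := by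
    have := isPreconnected_Icc.sub_eq_of_exp_eq (s := Set.Icc s₀ Real.pi)
      l.continuous.continuousOn (continuousOn_const (c := 0)) (fun s hs => ?_)
      (x := Real.pi) (y := s₀) ⟨hpi.le, le_rfl⟩ ⟨le_rfl, hpi.le⟩
    · simpa using this
    · have habs : |s| = s := abs_of_nonneg (hs0.le.trans hs.1)
      rw [hl, Complex.exp_zero, hcut' s (by rw [habs]; exact hs.1) (by rw [habs]; exact hs.2)]
  have hleft : l (-s₀) - l (-Real.pi) = 0 := by
    have := isPreconnected_Icc.sub_eq_of_exp_eq (s := Set.Icc (-Real.pi) (-s₀))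
      l.continuous.continuousOn (continuousOn_const (c := 0)) (fun s hs => ?_)
      (x := -s₀) (y := -Real.pi) ⟨neg_le_neg hpi.le, le_rfl⟩ ⟨le_rfl, neg_le_neg hpi.le⟩
    · simpa using this
    · have habs : |s| = -s := abs_of_nonpos (by linarith [hs.2])
      rw [hl, Complex.exp_zero, hcut' s (by linarith [hs.2]) (by linarith [hs.1])]
  -- On this arc arg (t - 1) goes from -π/2 to π/2 inside the slit plane, and z / conj z doubles the
  -- argument: one full turn.
  have hmid : l s₀ - l (-s₀) = 2 * Real.pi * Complex.I := by
    have hslit : ∀ s ∈ Set.Icc (-s₀) s₀, z s ∈ Complex.slitPlane := by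
      intro s hs
      have hs' : |s| ≤ s₀ := abs_le.2 hs
      have h1 := (one_le_re_figureEight_iff (hs'.trans hpi.le)).2 hs'
      have h3 : 0 ≤ (z s).re := by
        change 0 ≤ (figureEight _ _ - 1).re
        rw [Complex.sub_re, Complex.one_re]
        linarith
      rcases h3.lt_or_eq with h | h
      · exact Or.inl h
      · refine Or.inr fun h' => hz s (Complex.ext h.symm h')
    have hzc : Continuous z := by unfold z figureEight; fun_prop
    have hargc : ContinuousOn (fun s => 2 * ((z s).arg : ℂ) * Complex.I + Real.pi * Complex.I)
        (Set.Icc (-s₀) s₀) := by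
      have : ContinuousOn (fun s => (z s).arg) (Set.Icc (-s₀) s₀) := fun s hs =>
        ((Complex.continuousAt_arg (hslit s hs)).comp hzc.continuousAt).continuousWithinAt
      exact ((continuousOn_const.mul (Complex.continuous_ofReal.comp_continuousOn this)).mul
        continuousOn_const).add continuousOn_const
    have := isPreconnected_Icc.sub_eq_of_exp_eq (s := Set.Icc (-s₀) s₀)
      l.continuous.continuousOn hargc (fun s hs => ?_)
      (x := s₀) (y := -s₀) ⟨by linarith, le_rfl⟩ ⟨le_rfl, by linarith⟩
    · have a1 : (z s₀).arg = Real.pi / 2 := by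
        rw [Complex.arg_eq_pi_div_two_iff, hre, him, hcos]
        exact ⟨by norm_num, by positivity⟩
      have a2 : (z (-s₀)).arg = -(Real.pi / 2) := by
        rw [Complex.arg_eq_neg_pi_div_two_iff, hre, him, Real.cos_neg, Real.sin_neg, hcos]
        exact ⟨by norm_num, by nlinarith⟩
      rw [this, a1, a2]
      push_cast
      ring
    · rw [hl, hcut s (abs_le.2 hs), Complex.exp_add, Complex.exp_two_arg_mul_I (hz s),
        Complex.exp_pi_mul_I, mul_neg_one]
  linear_combination hright + hmid + hleft

end pencilCurve

end

/-! ### The cyclic covering F × V → B and the conclusion -/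

noncomputable section

namespace TopCat

theorem vertex_down {n : ℕ} (i : Fin (n + 1)) :
    (vertex i).down = stdSimplex.vertex (S := ℝ) i := by
  have : (default : SimplexCategory.toTop.{0}.obj (SimplexCategory.mk 0)).down =
      stdSimplex.vertex (S := ℝ) (0 : Fin 1) := Subsingleton.elim _ _
  change stdSimplex.map _ (default : SimplexCategory.toTop.{0}.obj (SimplexCategory.mk 0)).down = _
  rw [this, stdSimplex.map_vertex]
  rfl

end TopCat

namespace pencilCurve

variable {k m : ℕ}

theorem rotate_comp (g h : rootsOfUnity m ℂ) :
    (rotate m h).comp (rotate (k := k) m g) = rotate m (h * g) := by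
  ext v
  · exact (mul_assoc _ _ _).symm
  · rfl

theorem rotate_one : rotate (k := k) m 1 = ContinuousMap.id _ := by
  ext v
  · exact one_mul _
  · rfl

theorem exists_edge (hk : 3 ≤ k) (hm : 0 < m) :
    ∃ e : C(SimplexCategory.toTop.{0}.obj (SimplexCategory.mk 1), pencilCurve k m),
      e (TopCat.vertex 0) = e (TopCat.vertex 1) ∧
      TopCat.windingCochain (V := TopCat.of (pencilCurve k m))
        ⟨cut k m, continuous_cut hk hm⟩ (TopCat.ofSimplexMap e) = 1 ∧
      ∀ g, g ≠ 1 → TopCat.windingCochain (V := TopCat.of (pencilCurve k m))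
        ⟨cut k m, continuous_cut hk hm⟩ (TopCat.ofSimplexMap ((rotate m g).comp e)) = 0 := by
  obtain ⟨γ, h2, hγ, h0⟩ := exists_loop hk hm
  let τ : C(SimplexCategory.toTop.{0}.obj (SimplexCategory.mk 1), ℝ) :=
    ⟨fun p => Real.pi * (2 * p.down.1 1 - 1),
      continuous_const.mul ((continuous_const.mul ((continuous_apply 1).comp
        (continuous_subtype_val.comp continuous_uliftDown))).sub continuous_const)⟩
  have hτ0 : τ (TopCat.vertex 0) = -Real.pi := by
    refine (congrArg (fun p : stdSimplex ℝ (Fin 2) => Real.pi * (2 * p 1 - 1))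
      (TopCat.vertex_down (n := 1) 0)).trans ?_
    simp
  have hτ1 : τ (TopCat.vertex 1) = Real.pi := by
    refine (congrArg (fun p : stdSimplex ℝ (Fin 2) => Real.pi * (2 * p 1 - 1))
      (TopCat.vertex_down (n := 1) 1)).trans ?_
    norm_num
  let θ : C(pencilCurve k m, ℂ) := ⟨cut k m, continuous_cut hk hm⟩
  have hends : γ (τ (TopCat.vertex 0)) = γ (τ (TopCat.vertex 1)) := by rw [hτ0, hτ1, hγ]
  refine ⟨γ.comp τ, hends, ?_, fun g hg => ?_⟩
  · obtain ⟨l, hl⟩ := exists_continuous_log (θ.comp γ) fun s => cut_ne_zero hk _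
    refine TopCat.windingCochain_of_closed (V := TopCat.of (pencilCurve k m)) (θ := θ)
      (TopCat.ofSimplexMap (γ.comp τ)) hends (l.comp τ)
      (fun x => hl (τ x)) 1 ?_
    change l (τ _) - l (τ _) = _
    rw [hτ0, hτ1, log_loop_one hk hm h2 h0 l hl, Int.cast_one, one_mul]
  · obtain ⟨l, hl⟩ := exists_continuous_log (θ.comp ((rotate m g).comp γ))
      fun s => cut_ne_zero hk _
    refine TopCat.windingCochain_of_closed (V := TopCat.of (pencilCurve k m)) (θ := θ)
      (TopCat.ofSimplexMap ((rotate m g).comp (γ.comp τ))) (congrArg (rotate m g) hends)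
      (l.comp τ) (fun x => hl (τ x)) 0 ?_
    change l (τ _) - l (τ _) = _
    rw [hτ0, hτ1, log_loop_of_ne_one hm h2 h0 hg l hl, Int.cast_zero, zero_mul]

end pencilCurve

namespace MultiArrangement

open pencilCurve

variable {V ι : Type} [NormedAddCommGroup V] [NormedSpace ℂ V] [Fintype ι]

/-- The action of the roots of unity on the Milnor fiber by inverse scalar multiplication. -/
def monodromy (A : MultiArrangement V ι) (g : rootsOfUnity A.degree ℂ) :
    C(A.milnorFiber, A.milnorFiber) where
  toFun x := ⟨(((g⁻¹ : rootsOfUnity A.degree ℂ) : ℂˣ) : ℂ) • x.1, by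
    change A.poly _ = 1
    rw [poly_smul, (mem_rootsOfUnity' _ _).1 (g⁻¹).2, one_mul]
    exact x.2⟩
  continuous_toFun := by fun_prop

theorem monodromy_comp (A : MultiArrangement V ι) (g h : rootsOfUnity A.degree ℂ) :
    (A.monodromy h).comp (A.monodromy g) = A.monodromy (h * g) := by
  refine ContinuousMap.ext fun x => Subtype.ext ?_
  change (((h⁻¹ : rootsOfUnity A.degree ℂ) : ℂˣ) : ℂ) •
    (((g⁻¹ : rootsOfUnity A.degree ℂ) : ℂˣ) : ℂ) • x.1 = ((((h * g)⁻¹ : rootsOfUnity A.degree ℂ) : ℂˣ) : ℂ) • x.1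
  rw [smul_smul, mul_inv]
  rfl

theorem monodromy_one (A : MultiArrangement V ι) : A.monodromy 1 = ContinuousMap.id _ := by
  refine ContinuousMap.ext fun x => Subtype.ext ?_
  change (((1⁻¹ : rootsOfUnity A.degree ℂ) : ℂˣ) : ℂ) • x.1 = x.1
  simp

variable [DecidableEq ι] [FiniteDimensional ℂ V]

/-- The map `(x, (λ, t)) ↦ (λ x, t λ f_h(x))`, a cyclic covering of the Milnor fiber of the parallel
connection. -/
def milnorFiberProd (A : MultiArrangement V ι) (h : ι) :
    C(A.milnorFiber × pencilCurve (A.mult h) A.degree, (A.parallelConnection h).milnorFiber) where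
  toFun p := ⟨(p.2.1.1 • p.1.1, p.2.1.2 * (p.2.1.1 * A.form h p.1.1)), by
    change (A.parallelConnection h).poly _ = 1
    rw [parallelConnection_poly, p.2.2, one_mul]
    exact p.1.2⟩
  continuous_toFun := by
    have := (A.form h).continuous_of_finiteDimensional
    fun_prop

/-- The coordinate t = y₂ / f_h is determined by the point; a continuous logarithm of g(t) on `T`
then supplies λ, and x is the first component divided by λ. -/
theorem exists_lift_milnorFiberProd [Nonempty ι] (A : MultiArrangement V ι) (h : ι) {T : Type}
    [TopologicalSpace T] [ContractibleSpace T] (f : C(T, (A.parallelConnection h).milnorFiber)) :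
    ∃ (x : C(T, A.milnorFiber)) (v : C(T, pencilCurve (A.mult h) A.degree)),
      ∀ t, A.milnorFiberProd h (x t, v t) = f t := by
  have hform := (A.form h).continuous_of_finiteDimensional
  have h0 (t : T) : A.form h (f t).1.1 ≠ 0 := (milnorFiber_subset _ (f t).2) (Sum.inl h)
  let s : C(T, ℂ) := ⟨fun t => (f t).1.2 / A.form h (f t).1.1,
    Continuous.div (by fun_prop) (by fun_prop) h0⟩
  have hpoly (t : T) : pencilPoly (A.mult h) (s t) * A.poly (f t).1.1 = 1 := by
    have h1 := A.parallelConnection_poly h (f t).1.1 1 (s t)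
    rw [one_pow, one_mul, one_smul, one_mul] at h1
    rw [← h1, show s t * A.form h (f t).1.1 = (f t).1.2 from div_mul_cancel₀ _ (h0 t)]
    exact (f t).2
  obtain ⟨L, hL⟩ := exists_continuous_log ⟨fun t => pencilPoly (A.mult h) (s t),
    (continuous_pencilPoly _).comp s.continuous⟩ fun t => left_ne_zero_of_mul_eq_one (hpoly t)
  change ∀ t, Complex.exp (L t) = pencilPoly (A.mult h) (s t) at hL
  have hm : (A.degree : ℂ) ≠ 0 := by exact_mod_cast A.degree_pos.ne'
  have hl (t : T) : Complex.exp (-L t / A.degree) ^ A.degree * pencilPoly (A.mult h) (s t) = 1 := by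
    rw [← hL, ← Complex.exp_nat_mul, mul_div_cancel₀ _ hm, ← Complex.exp_add, neg_add_cancel,
      Complex.exp_zero]
  have hx (t : T) : A.poly ((Complex.exp (-L t / A.degree))⁻¹ • (f t).1.1) = 1 := by
    rw [poly_smul, inv_pow, inv_eq_of_mul_eq_one_right (hl t), hpoly]
  refine ⟨⟨fun t => ⟨_, hx t⟩, ?_⟩, ⟨fun t => ⟨(Complex.exp (-L t / A.degree), s t), hl t⟩, ?_⟩,
    fun t => Subtype.ext (Prod.ext ?_ ?_)⟩
  · refine Continuous.subtype_mk (Continuous.smul (Continuous.inv₀ (by fun_prop)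
      fun t => Complex.exp_ne_zero _) (by fun_prop)) _
  · fun_prop
  · exact smul_inv_smul₀ (Complex.exp_ne_zero _) _
  · change s t * (Complex.exp (-L t / A.degree) *
      A.form h ((Complex.exp (-L t / A.degree))⁻¹ • (f t).1.1)) = _
    rw [map_smul, smul_eq_mul, mul_inv_cancel_left₀ (Complex.exp_ne_zero _)]
    exact div_mul_cancel₀ _ (h0 t)

/-- Equal images force equal t, so the ratio of the two λ's is an m-th root of unity varying
continuously over a connected space, hence constant. -/
theorem exists_monodromy_of_milnorFiberProd_eq [Nonempty ι] (A : MultiArrangement V ι) (h : ι)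
    {T : Type} [TopologicalSpace T] [ContractibleSpace T] (x x' : C(T, A.milnorFiber))
    (v v' : C(T, pencilCurve (A.mult h) A.degree))
    (hxv : ∀ t, A.milnorFiberProd h (x t, v t) = A.milnorFiberProd h (x' t, v' t)) :
    ∃ g, ∀ t, x' t = A.monodromy g (x t) ∧ v' t = rotate A.degree g (v t) := by
  have hv (t : T) : (v t).1.1 ≠ 0 := fst_ne_zero A.degree_pos _
  have hv' (t : T) : (v' t).1.1 ≠ 0 := fst_ne_zero A.degree_pos _
  have h1 (t : T) : (v t).1.1 • (x t).1 = (v' t).1.1 • (x' t).1 :=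
    congrArg (fun z => z.1.1) (hxv t)
  have h2 (t : T) : (v t).1.2 = (v' t).1.2 := by
    have h3 : (v t).1.2 * ((v t).1.1 * A.form h (x t).1) =
        (v' t).1.2 * ((v' t).1.1 * A.form h (x' t).1) := congrArg (fun z => z.1.2) (hxv t)
    have h4 : (v t).1.1 * A.form h (x t).1 = (v' t).1.1 * A.form h (x' t).1 := by
      simpa using congrArg (A.form h) (h1 t)
    rw [← h4] at h3
    exact mul_right_cancel₀ (mul_ne_zero (hv t) (A.milnorFiber_subset (x t).2 h)) h3
  let r (t : T) : ℂ := (v' t).1.1 / (v t).1.1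
  have hr : Continuous r := Continuous.div (by fun_prop) (by fun_prop) hv
  have hrm (t : T) : r t ^ A.degree = 1 := by
    have h3 : (v t).1.1 ^ A.degree * pencilPoly (A.mult h) (v t).1.2 = 1 := (v t).2
    have h4 : (v' t).1.1 ^ A.degree * pencilPoly (A.mult h) (v' t).1.2 = 1 := (v' t).2
    rw [← h2] at h4
    rw [div_pow, div_eq_one_iff_eq (pow_ne_zero _ (hv t))]
    exact mul_right_cancel₀ (pencilCurve.pencilPoly_ne_zero (v t)) (h4.trans h3.symm)
  let t₀ : T := Classical.arbitrary T
  have := A.degree_pos.ne'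
  have : NeZero A.degree := ⟨this⟩
  refine ⟨rootsOfUnity.mkOfPowEq (r t₀) (hrm t₀), fun t => ?_⟩
  have ht : ((rootsOfUnity.mkOfPowEq (r t₀) (hrm t₀) : ℂˣ) : ℂ) = (v' t).1.1 / (v t).1.1 :=
    isPreconnected_univ.eq_of_pow_eq_one hr.continuousOn A.degree_pos (fun t _ => hrm t)
      (Set.mem_univ _) (Set.mem_univ _)
  refine ⟨Subtype.ext ?_, Subtype.ext (Prod.ext ?_ (h2 t).symm)⟩
  · change _ = (((_ : ℂˣ)⁻¹ : ℂˣ) : ℂ) • (x t).1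
    rw [Units.val_inv_eq_inv_val, ht, inv_div, div_eq_inv_mul, mul_smul, h1,
      inv_smul_smul₀ (hv' t)]
  · change _ = _ * (v t).1.1
    rw [ht, div_mul_cancel₀ _ (hv t)]

theorem exists_homology_retract [Nonempty ι] (A : MultiArrangement V ι) (h : ι) (hk : 3 ≤ A.mult h)
    (i : ℕ) :
    ∃ (u : integralHomology (i + 1) A.milnorFiber ⟶
        integralHomology (i + 2) (A.parallelConnection h).milnorFiber)
      (v : integralHomology (i + 2) (A.parallelConnection h).milnorFiber ⟶
        integralHomology (i + 1) A.milnorFiber), u ≫ v = 𝟙 _ := by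
  have : NeZero A.degree := ⟨A.degree_pos.ne'⟩
  have := Fintype.ofFinite (rootsOfUnity A.degree ℂ)
  obtain ⟨e, he, hone, hne⟩ := exists_edge hk A.degree_pos
  exact TopCat.exists_homology_retract (F := TopCat.of A.milnorFiber)
    (V := TopCat.of (pencilCurve (A.mult h) A.degree))
    (B := TopCat.of (A.parallelConnection h).milnorFiber) (A.milnorFiberProd h) A.monodromy
    (rotate A.degree) A.monodromy_comp A.monodromy_one rotate_comp rotate_one
    (fun T _ _ f => A.exists_lift_milnorFiberProd h f)
    (fun T _ _ x x' v v' hxv => A.exists_monodromy_of_milnorFiberProd_eq h x x' v v' hxv) _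
    (cut_ne_zero hk) e he hone hne i

end MultiArrangement

end

theorem mainTheorem10 {n : ℕ} {ι : Type} [Fintype ι] [DecidableEq ι] [Nonempty ι]
    (A : MultiArrangement (Fin (n + 1) → ℂ) ι) (h : ι) :
    (∀ (b : ℂ × ℂ) (hb : b ∈ (MultiArrangement.pencil (A.mult h)).affineComplement),
      ∃ φ : C(A.milnorFiber, (A.parallelConnection h).milnorFiber),
        (∀ (x y : A.milnorFiber) (ζ : ℂ), (y : Fin (n + 1) → ℂ) = ζ • (x : Fin (n + 1) → ℂ) →
          (φ y : (Fin (n + 1) → ℂ) × ℂ) = ζ • (φ x : (Fin (n + 1) → ℂ) × ℂ)) ∧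
        IsPullback (TopCat.ofHom φ) (TopCat.ofHom A.milnorCover)
          (TopCat.ofHom (A.parallelConnection h).milnorCover)
          (TopCat.ofHom (A.baseMap h b hb))) ∧
    (3 ≤ A.mult h → ∀ i : ℕ, 1 ≤ i →
      ∃ ψ : Submodule.torsion ℤ
            (integralHomology (i + 1) (A.parallelConnection h).milnorFiber) →+
          Submodule.torsion ℤ (integralHomology i A.milnorFiber),
        Function.Surjective ψ) := by
  refine ⟨fun b hb => A.exists_pullback_square h b hb, fun hk i hi => ?_⟩
  obtain ⟨i, rfl⟩ := Nat.exists_eq_add_of_le' hi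
  obtain ⟨u, v, huv⟩ := A.exists_homology_retract h hk i
  exact exists_surjective_torsion u v huv
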